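/- **Height estimate for the modified mean curvature flow.** Let $M^3=\mathbb H^3/\Gamma$ be an almost Fuchsian manifold, that is, a complete oriented hyperbolic three-manifold containing a closed oriented incompressible minimal surface $\Sigma$ whose inclusion $\Sigma\to M^3$ is a homotopy equivalence and whose principal curvatures $\pm\lambda(x)$, $\lambda(x)\ge 0$, lie in $(-1,1)$. Put $\lambda_{\max}=\max_{x\in\Sigma}\lambda(x)$. Let $r$ be the signed hyperbolic distance to $\Sigma$, and $\vec n=\partial/\partial r$ the unit field normal to the equidistant surfaces of $\Sigma$ (every point of $M^3$ is $\exp_x(r\,\vec n)$ for exactly one $x\in\Sigma$ and $r\in\mathbb R$). Let $c\in[0,2)$ and assume $$\lambda_{\max}\le \frac{\sqrt{2-c}}{2}.$$ Let $T>0$ and let $F(\cdot,t)$, $t\in[0,T]$, be a smooth family of immersed closed surfaces $S(t)$ in $M^3$ with smooth unit normal field $\vec\nu$, solving the modified mean curvature flow $$\frac{\partial F}{\partial t}=-(H-c)\,\vec\nu ,$$ where $H$ is the sum of the principal curvatures, with second fundamental form $h(X,Y)=\langle\overline\nabla_X\vec\nu,Y\rangle$. Assume that the angle function $\Theta=\langle\vec\nu,\vec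 n\rangle$ is nonnegative on $S(t)$ for all $t\in[0,T]$. Let $u(x,t)$ be the signed distance of $F(x,t)$ to $\Sigma$, and let $$\mathbf w(t)=\min_{S(t)}u,\qquad \mathbf v(t)=\max_{S(t)}u .$$ Assume $\mathbf w(0)=b_0>0$ and $\mathbf v(0)=a_0>0$. Set $$r_c=\tanh^{-1}\Big(\frac c2\Big),\qquad \widetilde b_0=\min\{b_0,r_c\},\qquad \widetilde r_c=\tanh^{-1}\left(\frac{c}{2-(2-c\tanh\widetilde b_0)\lambda_{\max}^2}\right).$$ Then for all $[T_1,T_2]\subset[0,T]$ and $t\in[T_1,T_2]$, $$\sinh^{-1}\!\big(e^{-\tau_1(t-T_1)}\sinh(\mathbf w(T_1)-r_c)\big)+r_c\;\le\;u(\cdot,t)\;\le\;\sinh^{-1}\!\big(e^{-\tau_2(t-T_1)}\sinh(\mathbf v(T_1)-\widetilde r_c)\big)+\widetilde r_c ,$$ where $$\tau_1=\begin{cases}4&\text{if }\mathbf w(T_1)\ge r_c,\\ \frac{2-c}{4}&\text{if }\mathbf w(T_1)\le r_c,\end{cases}\qquad \tau_2=\begin{cases}4&\text{if }\mathbf v(T_1)\le\widetilde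 r_c,\\ \frac{2-c}{4}&\text{if }\mathbf v(T_1)\ge\widetilde r_c.\end{cases}$$ (If equality holds in these conditions, both values give the same bound.) In particular, $$\min\{b_0,r_c\}\le u(x,t)\le\max\{a_0,\widetilde r_c\}\qquad\text{for all }t\in[0,T],$$ so the flow stays in the region $\{\min\{b_0,r_c\}\le r\le\max\{a_0,\widetilde r_c\}\}$ of $M^3$, which is compact and does not depend on $T$. -/

import Mathlib

open Set
open scoped Manifold ContDiff

noncomputable section

/-! ### Hyperbolic three-space: the hyperboloid in Minkowski space -/

/-- Minkowski space `ℝ^{1,3}`; the first factor is the time coordinate. -/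
abbrev Mink : Type := ℝ × EuclideanSpace ℝ (Fin 3)

/-- The parameter plane `ℝ²`. -/
abbrev Plane : Type := EuclideanSpace ℝ (Fin 2)

/-- The Lorentzian inner product. Its restriction to the tangent spaces of the hyperboloid is the
hyperbolic metric. -/
def mink (p q : Mink) : ℝ := inner ℝ p.2 q.2 - p.1 * q.1

/-- Hyperbolic three-space. -/
def hyp3 : Set Mink := {p | mink p p = -1 ∧ 0 < p.1}

/-- The hyperbolic distance of two points of `hyp3`. -/
def hypDist (p q : Mink) : ℝ := Real.arcosh (-mink p q)

/-- The hyperbolic exponential map: the point at signed distance `r` from `p` along the geodesic of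
`hyp3` that starts at `p` with unit velocity `n`. -/
def hypExp (p n : Mink) (r : ℝ) : Mink := Real.cosh r • p + Real.sinh r • n

/-- The velocity at time `r` of the geodesic `hypExp p n`. -/
def hypVel (p n : Mink) (r : ℝ) : Mink := Real.sinh r • p + Real.cosh r • n

/-! ### Curvature of surfaces in hyperbolic three-space

For an immersion `F` of a surface into `hyp3` with unit normal field `ν`, put `L = dF` and `N = dν`
at a point. Since `⟨ν, F⟩ = 0` and `⟨ν, dF⟩ = 0`, the vector `dν(v)` is tangent to `hyp3`, and so it is
the covariant derivative of `ν` along `v`. -/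

/-- The first fundamental form `g_ij = ⟨∂_i F, ∂_j F⟩`. -/
def firstForm (L : Plane →L[ℝ] Mink) : Matrix (Fin 2) (Fin 2) ℝ :=
  Matrix.of fun i j => mink (L (EuclideanSpace.single i 1)) (L (EuclideanSpace.single j 1))

/-- The second fundamental form `h_ij = ⟨∇_i ν, ∂_j F⟩`. -/
def secondForm (L N : Plane →L[ℝ] Mink) : Matrix (Fin 2) (Fin 2) ℝ :=
  Matrix.of fun i j => mink (N (EuclideanSpace.single i 1)) (L (EuclideanSpace.single j 1))

/-- The mean curvature `g^ij h_ij`, the sum of the principal curvatures. -/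
def meanCurv (L N : Plane →L[ℝ] Mink) : ℝ :=
  Matrix.trace ((firstForm L)⁻¹ * secondForm L N)

/-- `κ` is a principal curvature: an eigenvalue of the second fundamental form with respect to the
first one. -/
def IsPrincipalCurv (L N : Plane →L[ℝ] Mink) (κ : ℝ) : Prop :=
  ∃ v : Plane, v ≠ 0 ∧ ∀ w : Plane, mink (N v) (L w) = κ * mink (L v) (L w)

section Surface

variable {S : Type*} [TopologicalSpace S] [ChartedSpace Plane S]

/-- The differential at `x` of a map from a surface to Minkowski space, in the coordinates of the
preferred chart at `x`. -/
def surfDeriv (F : S → Mink) (x : S) : Plane →L[ℝ] Mink :=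
  mfderiv (𝓡 2) 𝓘(ℝ, Mink) F x

/-- The mean curvature at `x` of the immersion `F` with respect to the unit normal field `ν`. -/
def surfMeanCurv (F ν : S → Mink) (x : S) : ℝ :=
  meanCurv (surfDeriv F x) (surfDeriv ν x)

/-- A closed surface immersed in `ℍ³/Γ`, with a unit normal field `ν` in `ℍ³/Γ`, given on the
level of `ℍ³`: `S` is a covering of the closed surface with `Γ` acting as a group of covering
transformations through `ρ` (so the closed surface is `S/Γ`, and it is compact by `cocompact`), `F` is
the `Γ`-equivariant lift of the immersion, and `ν` is the lift of the unit normal. Every smooth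
immersion of a closed surface into `ℍ³/Γ` arises in this way, from the pull-back of the covering
`ℍ³ → ℍ³/Γ`. -/
structure IsClosedSurface (Γ : Subgroup (Mink ≃ₗ[ℝ] Mink)) (ρ : Γ →* Equiv.Perm S)
    (F ν : S → Mink) : Prop where
  smooth_action : ∀ γ : Γ, ContMDiff (𝓡 2) (𝓡 2) ∞ (ρ γ)
  cocompact : ∃ K : Set S, IsCompact K ∧ ∀ x : S, ∃ γ : Γ, ρ γ x ∈ K
  smooth : ContMDiff (𝓡 2) 𝓘(ℝ, Mink) ∞ F
  smooth_normal : ContMDiff (𝓡 2) 𝓘(ℝ, Mink) ∞ ν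
  mem : ∀ x, F x ∈ hyp3
  immersion : ∀ x, Function.Injective (surfDeriv F x)
  unit : ∀ x, mink (ν x) (ν x) = 1
  tangent : ∀ x, mink (ν x) (F x) = 0
  normal : ∀ x v, mink (ν x) (surfDeriv F x v) = 0
  equivariant : ∀ (γ : Γ) x, F (ρ γ x) = (γ : Mink ≃ₗ[ℝ] Mink) (F x)
  equivariant_normal : ∀ (γ : Γ) x, ν (ρ γ x) = (γ : Mink ≃ₗ[ℝ] Mink) (ν x)

/-- `F t`, for `t ∈ [0, T]`, is a smooth solution of the modified mean curvature flow
`∂F/∂t = -(H - c) ν` of closed surfaces in `ℍ³/Γ`, with unit normals `ν t`. -/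
structure IsMMCF (Γ : Subgroup (Mink ≃ₗ[ℝ] Mink)) (ρ : Γ →* Equiv.Perm S) (c T : ℝ)
    (F ν : ℝ → S → Mink) : Prop where
  surface : ∀ t ∈ Icc 0 T, IsClosedSurface Γ ρ (F t) (ν t)
  smooth : ContMDiffOn (𝓘(ℝ, ℝ).prod (𝓡 2)) 𝓘(ℝ, Mink) ∞
    (fun z : ℝ × S => F z.1 z.2) (Icc 0 T ×ˢ univ)
  smooth_normal : ContMDiffOn (𝓘(ℝ, ℝ).prod (𝓡 2)) 𝓘(ℝ, Mink) ∞
    (fun z : ℝ × S => ν z.1 z.2) (Icc 0 T ×ˢ univ)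
  flow : ∀ t ∈ Icc 0 T, ∀ x, HasDerivWithinAt (fun s => F s x)
    (-(surfMeanCurv (F t) (ν t) x - c) • ν t x) (Icc 0 T) t

end Surface

/-! ### Almost Fuchsian manifolds -/

/-- `Γ` is a torsion-free Kleinian group: a group of orientation preserving isometries of `hyp3` that
acts freely and properly discontinuously. -/
structure IsKleinian (Γ : Subgroup (Mink ≃ₗ[ℝ] Mink)) : Prop where
  isometry : ∀ γ ∈ Γ, ∀ p q, mink (γ p) (γ q) = mink p q
  maps_to : ∀ γ ∈ Γ, ∀ p ∈ hyp3, γ p ∈ hyp3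
  orientation : ∀ γ ∈ Γ, LinearMap.det (γ : Mink →ₗ[ℝ] Mink) = 1
  free : ∀ γ ∈ Γ, ∀ p ∈ hyp3, γ p = p → γ = 1
  discontinuous : ∀ K ⊆ hyp3, IsCompact K →
    {γ : Mink ≃ₗ[ℝ] Mink | γ ∈ Γ ∧ ∃ p ∈ K, γ p ∈ K}.Finite

/-- An almost Fuchsian manifold `ℍ³/Γ` with its closed oriented incompressible minimal surface `Σ` of
principal curvatures in `(-1, 1)`, such that `Σ → ℍ³/Γ` induces an isomorphism of fundamental
groups. The surface is given through its universal covering, which is the plane: `f` is the lift of the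
immersion, `n` is the unit normal field, and `ρ` is the action of `Γ = π₁(Σ)` by covering
transformations. The normal `n` points to the side of `Σ` on which the signed distance is positive. -/
structure AlmostFuchsian where
  Γ : Subgroup (Mink ≃ₗ[ℝ] Mink)
  kleinian : IsKleinian Γ
  ρ : Γ →* Equiv.Perm Plane
  f : Plane → Mink
  n : Plane → Mink
  surface : IsClosedSurface Γ ρ f n
  minimal : ∀ x, surfMeanCurv f n x = 0
  small : ∀ x κ, IsPrincipalCurv (surfDeriv f x) (surfDeriv n x) κ → |κ| < 1

namespace AlmostFuchsian

variable (A : AlmostFuchsian)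

/-- Two points of `hyp3` are equivalent if they lie in the same orbit of `Γ`. -/
def orbitSetoid : Setoid hyp3 where
  r p q := ∃ γ ∈ A.Γ, γ (p : Mink) = q
  iseqv :=
    { refl := fun _ => ⟨1, A.Γ.one_mem, rfl⟩
      symm := by
        rintro p q ⟨γ, hγ, h⟩
        refine ⟨γ⁻¹, A.Γ.inv_mem hγ, ?_⟩
        rw [← h]
        exact γ.symm_apply_apply _
      trans := by
        rintro p q s ⟨γ, hγ, h⟩ ⟨δ, hδ, k⟩
        refine ⟨δ * γ, A.Γ.mul_mem hδ hγ, ?_⟩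
        rw [← k, ← h]
        rfl }

/-- The manifold `M = ℍ³/Γ`, with the quotient topology. -/
abbrev Manifold : Type := Quotient A.orbitSetoid

/-- The set of the principal curvatures of `Σ` at all its points. They come in pairs `±λ(x)`. -/
def principalCurvs : Set ℝ :=
  {κ | ∃ x, IsPrincipalCurv (surfDeriv A.f x) (surfDeriv A.n x) κ}

/-- The distance to `Σ`. -/
def distSurf (p : Mink) : ℝ := ⨅ x : Plane, hypDist p (A.f x)

open Classical in
/-- The signed distance to `Σ`, positive on the side to which `n` points. -/
def height (p : Mink) : ℝ :=
  if ∃ x, p = hypExp (A.f x) (A.n x) (A.distSurf p) then A.distSurf p else -A.distSurf p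

/-- The angle function `⟨v, ∂/∂r⟩` of the vector `v` at the point `p` is nonnegative, where `∂/∂r` is the
velocity field of the unit speed geodesics that leave `Σ` in the direction of `n`. -/
def AngleNonneg (p v : Mink) : Prop :=
  ∀ x r, p = hypExp (A.f x) (A.n x) r → 0 ≤ mink v (hypVel (A.f x) (A.n x) r)

/-- The minimum of the height over a surface. -/
def minHeight {S : Type*} (F : S → Mink) : ℝ := sInf (range fun x => A.height (F x))

/-- The maximum of the height over a surface. -/
def maxHeight {S : Type*} (F : S → Mink) : ℝ := sSup (range fun x => A.height (F x))

/-- The region `α ≤ height ≤ β` of the manifold `M`. -/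
def slab (α β : ℝ) : Set A.Manifold :=
  {m | ∃ p : hyp3, Quotient.mk A.orbitSetoid p = m ∧ A.height p ∈ Icc α β}

end AlmostFuchsian

/-! ### The constants of the height estimate -/

/-- The number `r_c = tanh⁻¹ (c / 2)`. -/
def rc (c : ℝ) : ℝ := Real.artanh (c / 2)

/-- The number `b̃₀ = min {b₀, r_c}`. -/
def bTilde (c b₀ : ℝ) : ℝ := min b₀ (rc c)

/-- The number `r̃_c = tanh⁻¹ (c / (2 - (2 - c tanh b̃₀) λ²))`. -/
def rcTilde (c lam b₀ : ℝ) : ℝ :=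
  Real.artanh (c / (2 - (2 - c * Real.tanh (bTilde c b₀)) * lam ^ 2))

end

/-!
The theorem is a maximum principle for the height `u` above `Σ` along the flow. It has three parts.

*Fermi coordinates.* Since the principal curvatures of `Σ` lie in `(-1, 1)`, the normal exponential
map `(y, r) ↦ exp_{f(y)} (r n(y))` is a local diffeomorphism from `Plane × ℝ` to `hyp3`, and the
hyperbolic metric has the form `g_r + dr²` in these coordinates. Along a lift of a ray (straight in
the chart `p ↦ p.2` of `hyp3`) the coordinate `r` is Lipschitz, and `f` is proper because `Γ` acts
cocompactly on the surface and properly discontinuously on `hyp3`; so rays lift, and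
`normalExpChart_bijective` follows. The closest point of `Σ` to a given point is the foot point of a
normal geodesic, so the signed distance is the coordinate `r` (`height_normalExp`), and in
particular it is smooth.

*Comparison.* At a lowest point of an evolving surface, the surface is tangent to an equidistant
surface of `Σ`, the angle condition gives `ν = ∂/∂r`, and the second fundamental forms of the two
surfaces differ by the Hessian of `u` (`IsHeightCritical.secondForm_eq`). Hence `H` is at most the
mean curvature `2 tanh r (1 - λ²) / (1 - λ² tanh² r)` of the equidistant surface, while `u` changes
at the rate `c - H`. At a highest point the inequality for `H` is reversed.

*Barriers.* The bounds `0 ≤ λ² ≤ λ_max²` turn this into differential inequalities for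
`sinh (u - r_c)` and `sinh (u - r̃_c)` at the extremal points (`exists_le_cosh_mul`,
`exists_cosh_mul_le`). The minimum principle `nonneg_of_spatial_min` applies because the height is
`Γ`-invariant and the surfaces are compact modulo `Γ`. Constant barriers come first: they determine
the sign of `sinh (u - r_c)` or `sinh (u - r̃_c)`, which the exponential barriers need. The upper
barriers use the lower bound `u ≥ min {b₀, r_c}`.
-/

/-! ### Minkowski space -/

lemma mink_comm (p q : Mink) : mink p q = mink q p := by
  simp only [mink, real_inner_comm, mul_comm]

lemma mink_add_left (p q r : Mink) : mink (p + q) r = mink p r + mink q r := by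
  simp only [mink, Prod.fst_add, Prod.snd_add, inner_add_left]; ring

lemma mink_add_right (p q r : Mink) : mink p (q + r) = mink p q + mink p r := by
  simp only [mink, Prod.fst_add, Prod.snd_add, inner_add_right]; ring

lemma mink_smul_left (a : ℝ) (p q : Mink) : mink (a • p) q = a * mink p q := by
  simp only [mink, Prod.smul_fst, Prod.smul_snd, real_inner_smul_left, smul_eq_mul]; ring

lemma mink_smul_right (a : ℝ) (p q : Mink) : mink p (a • q) = a * mink p q := by
  simp only [mink, Prod.smul_fst, Prod.smul_snd, real_inner_smul_right, smul_eq_mul]; ring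

lemma mink_neg_left (p q : Mink) : mink (-p) q = -mink p q := by
  simp only [mink, Prod.fst_neg, Prod.snd_neg, inner_neg_left]; ring

lemma mink_neg_right (p q : Mink) : mink p (-q) = -mink p q := by
  simp only [mink, Prod.fst_neg, Prod.snd_neg, inner_neg_right]; ring

lemma mink_sub_left (p q r : Mink) : mink (p - q) r = mink p r - mink q r := by
  simp only [sub_eq_add_neg, mink_add_left, mink_neg_left]

lemma mink_sub_right (p q r : Mink) : mink p (q - r) = mink p q - mink p r := by
  simp only [sub_eq_add_neg, mink_add_right, mink_neg_right]

lemma mink_zero_left (q : Mink) : mink 0 q = 0 := by simp [mink]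

lemma continuous_mink {X : Type*} [TopologicalSpace X] {p q : X → Mink} (hp : Continuous p)
    (hq : Continuous q) : Continuous fun x => mink (p x) (q x) := by
  unfold mink
  fun_prop

lemma HasDerivAt.mink {p q : ℝ → Mink} {p' q' : Mink} {s : ℝ} (hp : HasDerivAt p p' s)
    (hq : HasDerivAt q q' s) :
    HasDerivAt (fun s => mink (p s) (q s)) (mink p' (q s) + mink (p s) q') s := by
  have h1 : HasDerivAt (fun s => (p s).1) p'.1 s :=
    (ContinuousLinearMap.fst ℝ ℝ (EuclideanSpace ℝ (Fin 3))).hasFDerivAt.comp_hasDerivAt s hp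
  have h2 : HasDerivAt (fun s => (p s).2) p'.2 s :=
    (ContinuousLinearMap.snd ℝ ℝ (EuclideanSpace ℝ (Fin 3))).hasFDerivAt.comp_hasDerivAt s hp
  have h3 : HasDerivAt (fun s => (q s).1) q'.1 s :=
    (ContinuousLinearMap.fst ℝ ℝ (EuclideanSpace ℝ (Fin 3))).hasFDerivAt.comp_hasDerivAt s hq
  have h4 : HasDerivAt (fun s => (q s).2) q'.2 s :=
    (ContinuousLinearMap.snd ℝ ℝ (EuclideanSpace ℝ (Fin 3))).hasFDerivAt.comp_hasDerivAt s hq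
  have := (h2.inner ℝ h4).sub (h1.mul h3)
  exact this.congr_deriv (by simp only [_root_.mink]; ring)

lemma hyp3_fst_sq {p : Mink} (hp : p ∈ hyp3) : p.1 ^ 2 = 1 + ‖p.2‖ ^ 2 := by
  have := hp.1
  simp only [mink, real_inner_self_eq_norm_sq] at this
  linarith

/-- A point of `hyp3` is determined by its spatial part, since its time coordinate is
`√(1 + ‖p.2‖²)`. -/
lemma hyp3_ext {p q : Mink} (hp : p ∈ hyp3) (hq : q ∈ hyp3) (h : p.2 = q.2) : p = q := by
  refine Prod.ext ?_ h
  have h1 := hyp3_fst_sq hp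
  have h2 := hyp3_fst_sq hq
  rw [h] at h1
  have h3 := hp.2
  have h4 := hq.2
  nlinarith

lemma hyp3_norm_lt {p : Mink} (hp : p ∈ hyp3) : ‖p.2‖ < p.1 := by
  have := hyp3_fst_sq hp
  have := hp.2
  nlinarith [norm_nonneg p.2]

/-- Vectors tangent to `hyp3` are spacelike. -/
lemma mink_self_pos {p v : Mink} (hp : p ∈ hyp3) (hv : mink v p = 0) (h0 : v ≠ 0) :
    0 < mink v v := by
  have h1 := hyp3_fst_sq hp
  have h2 := hp.2
  have h3 : v.1 * p.1 = inner ℝ v.2 p.2 := by simp only [mink] at hv; linarith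
  have h4 : |v.1 * p.1| ≤ ‖v.2‖ * ‖p.2‖ := h3 ▸ abs_real_inner_le_norm _ _
  have h5 : (v.1 * p.1) ^ 2 ≤ (‖v.2‖ * ‖p.2‖) ^ 2 :=
    sq_le_sq' (neg_le_of_abs_le h4) (le_of_abs_le h4)
  simp only [mink, real_inner_self_eq_norm_sq]
  have h6 : 0 < ‖v.2‖ := by
    rw [norm_pos_iff]
    intro h
    rw [h, inner_zero_left] at h3
    refine h0 (Prod.ext ?_ h)
    simpa [h2.ne'] using h3
  have h7 : 0 < ‖v.2‖ ^ 2 := by positivity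
  have h8 : v.1 ^ 2 * p.1 ^ 2 < ‖v.2‖ ^ 2 * p.1 ^ 2 := by nlinarith
  have := lt_of_mul_lt_mul_right h8 (by positivity)
  nlinarith

lemma mink_self_nonneg {p v : Mink} (hp : p ∈ hyp3) (hv : mink v p = 0) : 0 ≤ mink v v := by
  by_cases h0 : v = 0
  · simp [h0, mink]
  · exact (mink_self_pos hp hv h0).le

/-- The hyperbolic length of a vector is at most the Euclidean length of its spatial part. -/
lemma mink_self_le (v : Mink) : mink v v ≤ ‖v.2‖ ^ 2 := by
  simp only [mink, real_inner_self_eq_norm_sq]; nlinarith [sq_nonneg v.1]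

/-- The distance comparison that makes bounded sets of `hyp3` bounded in Minkowski space. -/
lemma fst_le_mink {p q : Mink} (hp : p ∈ hyp3) (hq : q ∈ hyp3) :
    q.1 ≤ (p.1 + ‖p.2‖) * (-mink p q) := by
  have h1 := hyp3_fst_sq hp
  have h3 := hyp3_norm_lt hp
  have h4 := hyp3_norm_lt hq
  have h5 := real_inner_le_norm p.2 q.2
  have h6 : q.1 * (p.1 - ‖p.2‖) ≤ -mink p q := by
    simp only [mink]; nlinarith [norm_nonneg p.2]
  calc q.1 = (p.1 + ‖p.2‖) * (q.1 * (p.1 - ‖p.2‖)) := by linear_combination -q.1 * h1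
    _ ≤ _ := mul_le_mul_of_nonneg_left h6 (by linarith [hp.2, norm_nonneg p.2])

/-- The expansion of a vector in a pseudo-orthonormal frame. -/
lemma mink_frame {p m a b : Mink} (hp : mink p p = -1) (hm : mink m m = 1) (ha : mink a a = 1)
    (hb : mink b b = 1) (hpm : mink p m = 0) (hpa : mink p a = 0) (hpb : mink p b = 0)
    (hma : mink m a = 0) (hmb : mink m b = 0) (hab : mink a b = 0) (v : Mink) :
    v = (-mink v p) • p + mink v m • m + mink v a • a + mink v b • b := by
  have hmp := (mink_comm m p).trans hpm
  have hap := (mink_comm a p).trans hpa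
  have hbp := (mink_comm b p).trans hpb
  have ham := (mink_comm a m).trans hma
  have hbm := (mink_comm b m).trans hmb
  have hba := (mink_comm b a).trans hab
  have hli : LinearIndependent ℝ ![p, m, a, b] := by
    rw [Fintype.linearIndependent_iff]
    intro g hg
    simp only [Fin.sum_univ_four, Matrix.cons_val] at hg
    have hx : ∀ x, mink (g 0 • p + g 1 • m + g 2 • a + g 3 • b) x = 0 := fun x => by
      rw [hg, mink_zero_left]
    simp only [mink_add_left, mink_smul_left] at hx
    have h0 := hx p
    have h1 := hx m
    have h2 := hx a
    have h3 := hx b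
    simp only [hp, hm, ha, hb, hpm, hpa, hpb, hma, hmb, hab, hmp, hap, hbp, ham, hbm, hba]
      at h0 h1 h2 h3
    intro i
    fin_cases i <;> simp <;> linarith
  have hspan := hli.span_eq_top_of_card_eq_finrank (by simp)
  have hv : v ∈ Submodule.span ℝ (range ![p, m, a, b]) := hspan ▸ Submodule.mem_top
  rw [Submodule.mem_span_range_iff_exists_fun] at hv
  obtain ⟨g, hg⟩ := hv
  simp only [Fin.sum_univ_four, Matrix.cons_val] at hg
  rw [← hg]
  simp only [mink_add_left, mink_smul_left, hp, hm, ha, hb, hpm, hpa, hpb, hma, hmb, hab, hmp, hap,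
    hbp, ham, hbm, hba]
  simp

/-! ### The geodesics of hyperbolic space -/

lemma mink_hypExp_self {p n : Mink} (hp : mink p p = -1) (hn : mink n n = 1) (hpn : mink n p = 0)
    (r : ℝ) : mink (hypExp p n r) (hypExp p n r) = -1 := by
  have := Real.cosh_sq r
  simp only [hypExp, mink_add_left, mink_add_right, mink_smul_left, mink_smul_right, hp, hn, hpn,
    mink_comm p n]
  linarith

lemma mink_hypVel_self {p n : Mink} (hp : mink p p = -1) (hn : mink n n = 1) (hpn : mink n p = 0)
    (r : ℝ) : mink (hypVel p n r) (hypVel p n r) = 1 := by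
  have := Real.cosh_sq r
  simp only [hypVel, mink_add_left, mink_add_right, mink_smul_left, mink_smul_right, hp, hn, hpn,
    mink_comm p n]
  linarith

lemma mink_hypVel_hypExp {p n : Mink} (hp : mink p p = -1) (hn : mink n n = 1) (hpn : mink n p = 0)
    (r : ℝ) : mink (hypVel p n r) (hypExp p n r) = 0 := by
  simp only [hypVel, hypExp, mink_add_left, mink_add_right, mink_smul_left, mink_smul_right, hp, hn,
    hpn, mink_comm p n]
  ring

lemma hypExp_mem {p n : Mink} (hp : p ∈ hyp3) (hn : mink n n = 1) (hpn : mink n p = 0)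
    (r : ℝ) : hypExp p n r ∈ hyp3 := by
  refine ⟨mink_hypExp_self hp.1 hn hpn r, ?_⟩
  by_contra hneg
  -- The time coordinate of the geodesic would vanish somewhere by continuity.
  have hs := mink_hypExp_self hp.1 hn hpn r
  have hc : Continuous fun s => (hypExp p n s).1 := by unfold hypExp; fun_prop
  have h0 : (hypExp p n 0).1 = p.1 := by simp [hypExp]
  obtain ⟨s, hs0⟩ : (0 : ℝ) ∈ range fun s => (hypExp p n s).1 :=
    mem_range_of_exists_le_of_exists_ge hc ⟨r, not_lt.1 hneg⟩ ⟨0, by rw [h0]; exact hp.2.le⟩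
  have := mink_hypExp_self hp.1 hn hpn s
  simp only at hs0
  simp only [mink, hs0, real_inner_self_eq_norm_sq] at this
  nlinarith [sq_nonneg ‖(hypExp p n s).2‖]

/-! ### The mean curvature in an orthonormal basis -/

lemma plane_eq (v : Plane) :
    v = v 0 • EuclideanSpace.single 0 1 + v 1 • EuclideanSpace.single 1 1 := by
  ext i; fin_cases i <;> simp

/-- The mean curvature is the trace of the second fundamental form in an orthonormal basis. -/
lemma meanCurv_eq {L N : Plane →L[ℝ] Mink} {v w : Plane} (hv : mink (L v) (L v) = 1)
    (hw : mink (L w) (L w) = 1) (hvw : mink (L v) (L w) = 0) :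
    meanCurv L N = mink (N v) (L v) + mink (N w) (L w) := by
  set Q : Matrix (Fin 2) (Fin 2) ℝ := !![v 0, w 0; v 1, w 1] with hQ
  have key : ∀ (M : Plane →L[ℝ] Mink) (x y : Plane), mink (M x) (L y) =
      x 0 * y 0 * mink (M (EuclideanSpace.single 0 1)) (L (EuclideanSpace.single 0 1)) +
      x 0 * y 1 * mink (M (EuclideanSpace.single 0 1)) (L (EuclideanSpace.single 1 1)) +
      x 1 * y 0 * mink (M (EuclideanSpace.single 1 1)) (L (EuclideanSpace.single 0 1)) +
      x 1 * y 1 * mink (M (EuclideanSpace.single 1 1)) (L (EuclideanSpace.single 1 1)) := by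
    intro M x y
    conv_lhs => rw [plane_eq x, plane_eq y]
    simp only [map_add, map_smul, mink_add_left, mink_add_right, mink_smul_left, mink_smul_right]
    ring
  have hwv : mink (L w) (L v) = 0 := by rw [mink_comm, hvw]
  have h1 : Q.transpose * firstForm L * Q = 1 := by
    rw [key] at hv hw hvw hwv
    ext i j
    fin_cases i <;> fin_cases j <;>
      simp [hQ, Matrix.mul_apply, Fin.sum_univ_two, firstForm] <;> linarith
  have h2 : firstForm L * (Q * Q.transpose) = 1 := by
    rw [Matrix.mul_assoc] at h1
    have := mul_eq_one_comm.1 h1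
    rw [Matrix.mul_assoc] at this
    exact this
  have h3 : (firstForm L)⁻¹ = Q * Q.transpose := Matrix.inv_eq_right_inv h2
  rw [meanCurv, h3, key N v v, key N w w]
  simp only [Matrix.trace_fin_two, Matrix.mul_apply, Fin.sum_univ_two, Matrix.transpose_apply,
    secondForm, Matrix.of_apply, hQ, Matrix.cons_val]
  ring

/-! ### Coordinate lines on a surface -/

section Surface

variable {S : Type*} [TopologicalSpace S] [ChartedSpace Plane S]

/-- The coordinate line through `x` with velocity `v`, in the preferred chart at `x`. -/
noncomputable def coordLine (x : S) (v : Plane) (s : ℝ) : S :=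
  (extChartAt (𝓡 2) x).symm (extChartAt (𝓡 2) x x + s • v)

lemma coordLine_zero (x : S) (v : Plane) : coordLine x v 0 = x := by
  simp [coordLine]

lemma eventually_coordLine (x : S) (v : Plane) :
    ∀ᶠ s in nhds (0 : ℝ), extChartAt (𝓡 2) x x + s • v ∈ (extChartAt (𝓡 2) x).target := by
  have hc : Continuous fun s : ℝ => extChartAt (𝓡 2) x x + s • v := by fun_prop
  refine hc.continuousAt.eventually_mem ?_
  simpa using extChartAt_target_mem_nhds (I := 𝓡 2) x

lemma hasDerivAt_coordLine_zero {G : S → Mink} {x : S} (hG : MDifferentiableAt (𝓡 2) 𝓘(ℝ, Mink) G x)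
    (v : Plane) : HasDerivAt (fun s => G (coordLine x v s)) (surfDeriv G x v) 0 := by
  have h := hG.hasMFDerivAt.2
  simp only [writtenInExtChartAt, extChartAt_model_space_eq_id, PartialEquiv.refl_coe,
    Function.id_comp, ModelWithCorners.range_eq_univ] at h
  replace h : HasFDerivAt (G ∘ (extChartAt (𝓡 2) x).symm) (surfDeriv G x) (extChartAt (𝓡 2) x x) :=
    hasFDerivWithinAt_univ.1 h
  have hl : HasDerivAt (fun s : ℝ => extChartAt (𝓡 2) x x + s • v) v 0 := by
    simpa using ((hasDerivAt_id (0 : ℝ)).smul_const v).const_add (extChartAt (𝓡 2) x x)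
  refine HasFDerivAt.comp_hasDerivAt (l := G ∘ (extChartAt (𝓡 2) x).symm) 0 ?_ hl
  rwa [zero_smul, add_zero]

variable {Γ : Subgroup (Mink ≃ₗ[ℝ] Mink)} {ρ : Γ →* Equiv.Perm S} {F ν : S → Mink}

namespace IsClosedSurface

variable (h : IsClosedSurface Γ ρ F ν)
include h

lemma hasDerivAt_map (x : S) (v : Plane) :
    HasDerivAt (fun s => F (coordLine x v s)) (surfDeriv F x v) 0 :=
  hasDerivAt_coordLine_zero (h.smooth.contMDiffAt.mdifferentiableAt (by simp)) v

lemma hasDerivAt_normal (x : S) (v : Plane) :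
    HasDerivAt (fun s => ν (coordLine x v s)) (surfDeriv ν x v) 0 :=
  hasDerivAt_coordLine_zero (h.smooth_normal.contMDiffAt.mdifferentiableAt (by simp)) v

lemma mink_deriv_self (x : S) (v : Plane) : mink (surfDeriv F x v) (F x) = 0 := by
  have h1 := (h.hasDerivAt_map x v).mink (h.hasDerivAt_map x v)
  have h2 : (fun s => mink (F (coordLine x v s)) (F (coordLine x v s))) = fun _ => -1 :=
    funext fun s => (h.mem _).1
  rw [h2, coordLine_zero] at h1
  have := h1.unique (hasDerivAt_const (0 : ℝ) (-1 : ℝ))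
  rw [mink_comm (F x)] at this
  linarith

lemma mink_normalDeriv_normal (x : S) (v : Plane) : mink (surfDeriv ν x v) (ν x) = 0 := by
  have h1 := (h.hasDerivAt_normal x v).mink (h.hasDerivAt_normal x v)
  have h2 : (fun s => mink (ν (coordLine x v s)) (ν (coordLine x v s))) = fun _ => 1 :=
    funext fun s => h.unit _
  rw [h2, coordLine_zero] at h1
  have := h1.unique (hasDerivAt_const (0 : ℝ) (1 : ℝ))
  rw [mink_comm (ν x)] at this
  linarith

lemma mink_normalDeriv_self (x : S) (v : Plane) : mink (surfDeriv ν x v) (F x) = 0 := by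
  have h1 := (h.hasDerivAt_normal x v).mink (h.hasDerivAt_map x v)
  have h2 : (fun s => mink (ν (coordLine x v s)) (F (coordLine x v s))) = fun _ => 0 :=
    funext fun s => h.tangent _
  rw [h2, coordLine_zero] at h1
  have := h1.unique (hasDerivAt_const (0 : ℝ) (0 : ℝ))
  rw [h.normal] at this
  linarith

lemma mink_deriv_pos (x : S) {v : Plane} (hv : v ≠ 0) :
    0 < mink (surfDeriv F x v) (surfDeriv F x v) :=
  mink_self_pos (h.mem x) (h.mink_deriv_self x v)
    ((map_ne_zero_iff _ (h.immersion x)).2 hv)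

end IsClosedSurface

variable [IsManifold (𝓡 2) ∞ S]

lemma contMDiffAt_coordLine {x : S} {v : Plane} {s : ℝ}
    (hs : extChartAt (𝓡 2) x x + s • v ∈ (extChartAt (𝓡 2) x).target) :
    ContMDiffAt 𝓘(ℝ, ℝ) (𝓡 2) ∞ (coordLine x v) s := by
  have h1 : ContMDiffAt 𝓘(ℝ, Plane) (𝓡 2) ∞ (extChartAt (𝓡 2) x).symm
      (extChartAt (𝓡 2) x x + s • v) :=
    (contMDiffOn_extChartAt_symm x).contMDiffAt
      ((isOpen_extChartAt_target (I := 𝓡 2) x).mem_nhds hs)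
  have h2 : ContMDiffAt 𝓘(ℝ, ℝ) 𝓘(ℝ, Plane) ∞ (fun s : ℝ => extChartAt (𝓡 2) x x + s • v) s := by
    have : ContDiff ℝ ∞ (fun s : ℝ => extChartAt (𝓡 2) x x + s • v) := by fun_prop
    exact this.contMDiff.contMDiffAt
  exact h1.comp s h2

lemma contDiffAt_comp_coordLine {G : S → Mink} (hG : ContMDiff (𝓡 2) 𝓘(ℝ, Mink) ∞ G) {x : S}
    {v : Plane} {s : ℝ}
    (hs : extChartAt (𝓡 2) x x + s • v ∈ (extChartAt (𝓡 2) x).target) :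
    ContDiffAt ℝ ∞ (fun s => G (coordLine x v s)) s :=
  ((hG.contMDiffAt).comp s (contMDiffAt_coordLine hs)).contDiffAt

/-- The velocity of the coordinate line, in the preferred chart at its moving point. -/
lemma exists_hasDerivAt_coordLine {x : S} {v : Plane} {s : ℝ}
    (hs : extChartAt (𝓡 2) x x + s • v ∈ (extChartAt (𝓡 2) x).target) :
    ∃ w : Plane, ∀ G : S → Mink, ContMDiff (𝓡 2) 𝓘(ℝ, Mink) ∞ G →
      HasDerivAt (fun s => G (coordLine x v s)) (surfDeriv G (coordLine x v s) w) s := by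
  have hc := (contMDiffAt_coordLine hs).mdifferentiableAt (by simp)
  set c' : ℝ →L[ℝ] Plane := mfderiv 𝓘(ℝ, ℝ) (𝓡 2) (coordLine x v) s with hc'
  refine ⟨c' 1, fun G hG => ?_⟩
  have hG' : MDifferentiableAt (𝓡 2) 𝓘(ℝ, Mink) G (coordLine x v s) :=
    hG.contMDiffAt.mdifferentiableAt (by simp)
  have h : HasFDerivAt (fun s => G (coordLine x v s)) ((surfDeriv G (coordLine x v s)).comp c') s :=
    (hG'.hasMFDerivAt.comp s hc.hasMFDerivAt).hasFDerivAt
  simpa using h.hasDerivAt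

end Surface

/-- Gram–Schmidt for a metric on the parameter plane. -/
lemma exists_orthonormal {L : Plane →L[ℝ] Mink} (hL : ∀ v ≠ 0, 0 < mink (L v) (L v)) :
    ∃ v w : Plane, mink (L v) (L v) = 1 ∧ mink (L w) (L w) = 1 ∧ mink (L v) (L w) = 0 := by
  have unit : ∀ v : Plane, v ≠ 0 →
      mink (L ((√(mink (L v) (L v)))⁻¹ • v)) (L ((√(mink (L v) (L v)))⁻¹ • v)) = 1 := by
    intro v hv
    have h1 := hL v hv
    have h2 := Real.sq_sqrt h1.le
    have h3 : √(mink (L v) (L v)) ≠ 0 := (Real.sqrt_pos.2 h1).ne'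
    rw [map_smul, mink_smul_left, mink_smul_right]
    field_simp
    exact h2.symm
  set u : Plane := EuclideanSpace.single 0 1 with hu
  have hu0 : u ≠ 0 := by simp [hu]
  obtain ⟨v, hv, hv1⟩ : ∃ v, v = (√(mink (L u) (L u)))⁻¹ • u ∧ mink (L v) (L v) = 1 :=
    ⟨_, rfl, unit u hu0⟩
  obtain ⟨z, hz⟩ : ∃ z : Plane,
      z = EuclideanSpace.single 1 1 - mink (L v) (L (EuclideanSpace.single 1 1)) • v := ⟨_, rfl⟩
  have hz0 : z ≠ 0 := by
    intro h
    have := congrArg (fun p : Plane => p 1) h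
    simp [hz, hv, hu] at this
  have hvz : mink (L v) (L z) = 0 := by
    rw [hz, map_sub, map_smul, mink_sub_right, mink_smul_right, hv1]; ring
  refine ⟨v, _, hv1, unit z hz0, ?_⟩
  rw [map_smul, mink_smul_right, hvz, mul_zero]

/-! ### Equidistant surfaces of the minimal surface -/

namespace AlmostFuchsian

variable (A : AlmostFuchsian)

lemma contDiff_f : ContDiff ℝ ∞ A.f := A.surface.smooth.contDiff

lemma contDiff_n : ContDiff ℝ ∞ A.n := A.surface.smooth_normal.contDiff

lemma hasFDerivAt_f (y : Plane) : HasFDerivAt A.f (surfDeriv A.f y) y := by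
  have h := (A.contDiff_f.differentiable (by simp) y).hasFDerivAt
  rwa [← mfderiv_eq_fderiv] at h

lemma hasFDerivAt_n (y : Plane) : HasFDerivAt A.n (surfDeriv A.n y) y := by
  have h := (A.contDiff_n.differentiable (by simp) y).hasFDerivAt
  rwa [← mfderiv_eq_fderiv] at h

/-- The second fundamental form of `Σ` is symmetric, because `⟨dn(v), df(w)⟩ = -⟨n, D²f(v, w)⟩`. -/
lemma secondForm_symm (y v w : Plane) :
    mink (surfDeriv A.n y v) (surfDeriv A.f y w) =
      mink (surfDeriv A.n y w) (surfDeriv A.f y v) := by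
  have hD : Differentiable ℝ (fderiv ℝ A.f) :=
    (A.contDiff_f.fderiv_right (m := ∞) (by simp)).differentiable (by simp)
  have hs : IsSymmSndFDerivAt ℝ A.f y :=
    A.contDiff_f.contDiffAt.isSymmSndFDerivAt 
      (by simpa using WithTop.coe_le_coe.2 (le_top : (2 : ℕ∞) ≤ ⊤))
  have key : ∀ v w : Plane, mink (surfDeriv A.n y v) (surfDeriv A.f y w) =
      -mink (A.n y) (fderiv ℝ (fderiv ℝ A.f) y v w) := by
    intro v w
    have hl : HasDerivAt (fun s : ℝ => y + s • v) v 0 := by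
      simpa using ((hasDerivAt_id (0 : ℝ)).smul_const v).const_add y
    have h1 : HasDerivAt (fun s : ℝ => A.n (y + s • v)) (surfDeriv A.n y v) 0 :=
      HasFDerivAt.comp_hasDerivAt (0 : ℝ) (by simpa using A.hasFDerivAt_n y) hl
    have h2 : HasDerivAt (fun s : ℝ => fderiv ℝ A.f (y + s • v))
        (fderiv ℝ (fderiv ℝ A.f) y v) 0 :=
      HasFDerivAt.comp_hasDerivAt (0 : ℝ) (by simpa using (hD y).hasFDerivAt) hl
    have h3 : HasDerivAt (fun s : ℝ => fderiv ℝ A.f (y + s • v) w)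
        (fderiv ℝ (fderiv ℝ A.f) y v w) 0 := by
      simpa using h2.clm_apply (hasDerivAt_const 0 w)
    have h4 := h1.mink h3
    have h5 : (fun s : ℝ => mink (A.n (y + s • v)) (fderiv ℝ A.f (y + s • v) w)) = fun _ => 0 := by
      funext s
      have := A.surface.normal (y + s • v) w
      rwa [surfDeriv, mfderiv_eq_fderiv] at this
    rw [h5] at h4
    have h6 := h4.unique (hasDerivAt_const (0 : ℝ) (0 : ℝ))
    have h7 : surfDeriv A.f y = fderiv ℝ A.f y := by rw [surfDeriv, mfderiv_eq_fderiv]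
    simp only [zero_smul, add_zero, ← h7] at h6
    linarith
  rw [key v w, key w v, hs v w]

/-- The shape operator of the minimal surface in an orthonormal basis: it is symmetric and
trace-free, and its eigenvalues are `±√(a² + b²)`. -/
lemma exists_shape (y : Plane) : ∃ (e₁ e₂ : Plane) (a b : ℝ),
    mink (surfDeriv A.f y e₁) (surfDeriv A.f y e₁) = 1 ∧
    mink (surfDeriv A.f y e₂) (surfDeriv A.f y e₂) = 1 ∧
    mink (surfDeriv A.f y e₁) (surfDeriv A.f y e₂) = 0 ∧
    surfDeriv A.n y e₁ = a • surfDeriv A.f y e₁ + b • surfDeriv A.f y e₂ ∧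
    surfDeriv A.n y e₂ = b • surfDeriv A.f y e₁ - a • surfDeriv A.f y e₂ ∧
    IsPrincipalCurv (surfDeriv A.f y) (surfDeriv A.n y) (√(a ^ 2 + b ^ 2)) := by
  have hA := A.surface
  obtain ⟨e₁, e₂, h11, h22, h12⟩ := exists_orthonormal (L := surfDeriv A.f y)
    fun v hv => hA.mink_deriv_pos y hv
  have hd := hA.mink_deriv_self y
  have hfr := mink_frame (hA.mem y).1 (hA.unit y) h11 h22
    ((mink_comm _ _).trans (hA.tangent y)) ((mink_comm _ _).trans (hd e₁))
    ((mink_comm _ _).trans (hd e₂)) (hA.normal y e₁) (hA.normal y e₂) h12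
  have hN : ∀ v, surfDeriv A.n y v =
      mink (surfDeriv A.n y v) (surfDeriv A.f y e₁) • surfDeriv A.f y e₁
      + mink (surfDeriv A.n y v) (surfDeriv A.f y e₂) • surfDeriv A.f y e₂ := by
    intro v
    conv_lhs => rw [hfr (surfDeriv A.n y v)]
    rw [hA.mink_normalDeriv_self, hA.mink_normalDeriv_normal]
    simp
  have htr : mink (surfDeriv A.n y e₁) (surfDeriv A.f y e₁) +
      mink (surfDeriv A.n y e₂) (surfDeriv A.f y e₂) = 0 :=
    (meanCurv_eq h11 h22 h12).symm.trans (A.minimal y)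
  have hN1 := hN e₁
  have hN2 := hN e₂
  rw [A.secondForm_symm y e₂ e₁, eq_neg_of_add_eq_zero_right htr] at hN2
  set a := mink (surfDeriv A.n y e₁) (surfDeriv A.f y e₁)
  set b := mink (surfDeriv A.n y e₁) (surfDeriv A.f y e₂)
  rw [neg_smul, ← sub_eq_add_neg] at hN2
  refine ⟨e₁, e₂, a, b, h11, h22, h12, hN1, hN2, ?_⟩
  -- The vector `b e₁ + (l - a) e₂` is an eigenvector for `l = √(a² + b²)`, unless it vanishes.
  set l := √(a ^ 2 + b ^ 2) with hl
  have hl2 : l ^ 2 = a ^ 2 + b ^ 2 := Real.sq_sqrt (by positivity)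
  have hl0 : 0 ≤ l := Real.sqrt_nonneg _
  have key : ∀ x z : ℝ, x ^ 2 + z ^ 2 ≠ 0 → a * x + b * z = l * x → b * x - a * z = l * z →
      IsPrincipalCurv (surfDeriv A.f y) (surfDeriv A.n y) l := by
    intro x z hne h1 h2
    refine ⟨x • e₁ + z • e₂, ?_, ?_⟩
    · intro h0
      have h3 := congrArg (fun v => mink (surfDeriv A.f y v) (surfDeriv A.f y v)) h0
      have h21 := (mink_comm _ _).trans h12
      simp only [map_add, map_smul, mink_add_left, mink_add_right, mink_smul_left, mink_smul_right,
        h11, h22, h12, h21, map_zero, mink_zero_left] at h3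
      exact hne (by linarith)
    · intro w
      rw [← mink_smul_left]
      congr 1
      simp only [map_add, map_smul, hN1, hN2]
      have e1 : x • (a • (surfDeriv A.f y) e₁ + b • (surfDeriv A.f y) e₂) +
          z • (b • (surfDeriv A.f y) e₁ - a • (surfDeriv A.f y) e₂) =
          (a * x + b * z) • (surfDeriv A.f y) e₁ + (b * x - a * z) • (surfDeriv A.f y) e₂ := by
        module
      rw [e1, h1, h2]
      module
  by_cases hz : b ^ 2 + (l - a) ^ 2 = 0
  · have hb : b = 0 := by nlinarith [sq_nonneg b, sq_nonneg (l - a)]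
    have ha : l = a := by nlinarith [sq_nonneg b, sq_nonneg (l - a)]
    exact key 1 0 (by norm_num) (by rw [ha]; ring) (by rw [hb]; ring)
  · exact key b (l - a) hz (by ring) (by linear_combination -hl2)

/-- The normal exponential map of the minimal surface, `(y, r) ↦ exp_{f(y)} (r n(y))`. -/
noncomputable def normalExp (z : Plane × ℝ) : Mink := hypExp (A.f z.1) (A.n z.1) z.2

/-- The unit field `∂/∂r` along the normal exponential map. -/
noncomputable def normalVel (z : Plane × ℝ) : Mink := hypVel (A.f z.1) (A.n z.1) z.2

/-- The differential of the parametrization `y ↦ normalExp (y, r)` of an equidistant surface. -/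
noncomputable def levelDeriv (z : Plane × ℝ) : Plane →L[ℝ] Mink :=
  Real.cosh z.2 • surfDeriv A.f z.1 + Real.sinh z.2 • surfDeriv A.n z.1

/-- The differential of the normal field `y ↦ normalVel (y, r)` of an equidistant surface. -/
noncomputable def levelNormalDeriv (z : Plane × ℝ) : Plane →L[ℝ] Mink :=
  Real.sinh z.2 • surfDeriv A.f z.1 + Real.cosh z.2 • surfDeriv A.n z.1

lemma levelDeriv_apply (z : Plane × ℝ) (v : Plane) : A.levelDeriv z v =
    Real.cosh z.2 • surfDeriv A.f z.1 v + Real.sinh z.2 • surfDeriv A.n z.1 v := rfl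

lemma levelNormalDeriv_apply (z : Plane × ℝ) (v : Plane) : A.levelNormalDeriv z v =
    Real.sinh z.2 • surfDeriv A.f z.1 v + Real.cosh z.2 • surfDeriv A.n z.1 v := rfl

lemma normalExp_mem (z : Plane × ℝ) : A.normalExp z ∈ hyp3 :=
  hypExp_mem (A.surface.mem _) (A.surface.unit _) (A.surface.tangent _) _

lemma mink_normalVel_self (z : Plane × ℝ) : mink (A.normalVel z) (A.normalVel z) = 1 :=
  mink_hypVel_self (A.surface.mem _).1 (A.surface.unit _) (A.surface.tangent _) _

lemma mink_normalVel_normalExp (z : Plane × ℝ) : mink (A.normalVel z) (A.normalExp z) = 0 :=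
  mink_hypVel_hypExp (A.surface.mem _).1 (A.surface.unit _) (A.surface.tangent _) _

lemma mink_levelDeriv_normalExp (z : Plane × ℝ) (v : Plane) :
    mink (A.levelDeriv z v) (A.normalExp z) = 0 := by
  have hA := A.surface
  simp only [levelDeriv_apply, normalExp, hypExp, mink_add_left, mink_add_right, mink_smul_left,
    mink_smul_right, hA.mink_deriv_self, hA.mink_normalDeriv_self,
    mink_comm _ (A.n _), hA.normal]
  rw [mink_comm, hA.mink_normalDeriv_normal]
  ring

lemma mink_levelDeriv_normalVel (z : Plane × ℝ) (v : Plane) :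
    mink (A.levelDeriv z v) (A.normalVel z) = 0 := by
  have hA := A.surface
  simp only [levelDeriv_apply, normalVel, hypVel, mink_add_left, mink_add_right, mink_smul_left,
    mink_smul_right, hA.mink_deriv_self, hA.mink_normalDeriv_self,
    mink_comm _ (A.n _), hA.normal]
  rw [mink_comm, hA.mink_normalDeriv_normal]
  ring

/-- An orthonormal basis for the metric of an equidistant surface, and the mean curvature of that
surface; `m` is the square of the principal curvature of the minimal surface. -/
lemma exists_levelFrame (z : Plane × ℝ) : ∃ (w₁ w₂ : Plane) (m : ℝ), 0 ≤ m ∧ m < 1 ∧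
    IsPrincipalCurv (surfDeriv A.f z.1) (surfDeriv A.n z.1) (√m) ∧
    mink (A.levelDeriv z w₁) (A.levelDeriv z w₁) = 1 ∧
    mink (A.levelDeriv z w₂) (A.levelDeriv z w₂) = 1 ∧
    mink (A.levelDeriv z w₁) (A.levelDeriv z w₂) = 0 ∧
    mink (A.levelNormalDeriv z w₁) (A.levelDeriv z w₁) +
      mink (A.levelNormalDeriv z w₂) (A.levelDeriv z w₂) =
      2 * Real.sinh z.2 * Real.cosh z.2 * (1 - m) /
        (Real.cosh z.2 ^ 2 - Real.sinh z.2 ^ 2 * m) := by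
  obtain ⟨y, r⟩ := z
  obtain ⟨e₁, e₂, a, b, h11, h22, h12, h1, h2, hp⟩ := A.exists_shape y
  have hm0 : 0 ≤ a ^ 2 + b ^ 2 := by positivity
  have hm1 : a ^ 2 + b ^ 2 < 1 := by
    have h3 := A.small y _ hp
    rw [abs_of_nonneg (Real.sqrt_nonneg _), Real.sqrt_lt' one_pos] at h3
    simpa using h3
  have h21 := (mink_comm _ _).trans h12
  have hcs := Real.cosh_sq r
  simp only [levelDeriv_apply, levelNormalDeriv_apply]
  generalize Real.cosh r = C at *
  generalize Real.sinh r = s at *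
  set D := C ^ 2 - s ^ 2 * (a ^ 2 + b ^ 2) with hD
  have hD0 : D ≠ 0 := by
    have : 0 < D := by nlinarith [sq_nonneg s]
    exact this.ne'
  set E₁ := surfDeriv A.f y e₁
  set E₂ := surfDeriv A.f y e₂
  set w₁ := ((C - s * a) / D) • e₁ - (s * b / D) • e₂ with hw1
  set w₂ := ((C + s * a) / D) • e₂ - (s * b / D) • e₁ with hw2
  have hL1 : C • surfDeriv A.f y w₁ + s • surfDeriv A.n y w₁ = E₁ := by
    simp only [hw1, map_sub, map_smul, h1, h2]
    have : C • (((C - s * a) / D) • E₁ - (s * b / D) • E₂) +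
      s • (((C - s * a) / D) • (a • E₁ + b • E₂) - (s * b / D) • (b • E₁ - a • E₂)) =
      ((C ^ 2 - s ^ 2 * (a ^ 2 + b ^ 2)) / D) • E₁ := by module
    rw [this, ← hD, div_self hD0, one_smul]
  have hL2 : C • surfDeriv A.f y w₂ + s • surfDeriv A.n y w₂ = E₂ := by
    simp only [hw2, map_sub, map_smul, h1, h2]
    have : C • (((C + s * a) / D) • E₂ - (s * b / D) • E₁) +
      s • (((C + s * a) / D) • (b • E₁ - a • E₂) - (s * b / D) • (a • E₁ + b • E₂)) =
      ((C ^ 2 - s ^ 2 * (a ^ 2 + b ^ 2)) / D) • E₂ := by module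
    rw [this, ← hD, div_self hD0, one_smul]
  refine ⟨w₁, w₂, a ^ 2 + b ^ 2, hm0, hm1, hp, ?_⟩
  simp only [hL1, hL2]
  refine ⟨h11, h22, h12, ?_⟩
  simp only [hw1, hw2, map_sub, map_smul, h1, h2, mink_add_left, mink_sub_left, mink_smul_left, E₁,
    E₂, h11, h22, h12, h21]
  rw [← hD]
  field_simp
  ring

/-- The differential of the normal exponential map splits the tangent space into the tangent
plane of the equidistant surface and the line spanned by `∂/∂r`. -/
lemma exists_levelDeriv_add {z : Plane × ℝ} {v : Mink} (hv : mink v (A.normalExp z) = 0) :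
    ∃ w, v = A.levelDeriv z w + mink v (A.normalVel z) • A.normalVel z := by
  obtain ⟨w₁, w₂, m, -, -, -, h11, h22, h12, -⟩ := A.exists_levelFrame z
  have h := mink_frame (A.normalExp_mem z).1 (A.mink_normalVel_self z) h11 h22
    ((mink_comm _ _).trans (A.mink_normalVel_normalExp z))
    ((mink_comm _ _).trans (A.mink_levelDeriv_normalExp z _))
    ((mink_comm _ _).trans (A.mink_levelDeriv_normalExp z _))
    ((mink_comm _ _).trans (A.mink_levelDeriv_normalVel z _))
    ((mink_comm _ _).trans (A.mink_levelDeriv_normalVel z _)) h12 v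
  refine ⟨mink v (A.levelDeriv z w₁) • w₁ + mink v (A.levelDeriv z w₂) • w₂, ?_⟩
  rw [hv, neg_zero, zero_smul, zero_add] at h
  rw [map_add, map_smul, map_smul]
  conv_lhs => rw [h]
  abel

lemma mink_levelDeriv_pos (z : Plane × ℝ) {v : Plane} (hv : v ≠ 0) :
    0 < mink (A.levelDeriv z v) (A.levelDeriv z v) := by
  refine mink_self_pos (A.normalExp_mem z) (A.mink_levelDeriv_normalExp z v) ?_
  obtain ⟨w₁, w₂, m, -, -, -, h11, h22, h12, -⟩ := A.exists_levelFrame z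
  have h21 := (mink_comm _ _).trans h12
  -- The map is injective on a plane, since its range contains two independent vectors.
  have hli : LinearIndependent ℝ ![w₁, w₂] := by
    rw [LinearIndependent.pair_iff]
    intro s t hst
    have h0 : A.levelDeriv z (s • w₁ + t • w₂) = 0 := by rw [hst, map_zero]
    rw [map_add, map_smul, map_smul] at h0
    have h1 := congrArg (fun x => mink x (A.levelDeriv z w₁)) h0
    have h2 := congrArg (fun x => mink x (A.levelDeriv z w₂)) h0
    simp only [mink_add_left, mink_smul_left, h11, h22, h12, h21, mink_zero_left] at h1 h2
    exact ⟨by linarith, by linarith⟩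
  have hspan := hli.span_eq_top_of_card_eq_finrank (by simp)
  have hv' : v ∈ Submodule.span ℝ (range ![w₁, w₂]) := hspan ▸ Submodule.mem_top
  rw [Submodule.mem_span_range_iff_exists_fun] at hv'
  obtain ⟨g, hg⟩ := hv'
  simp only [Fin.sum_univ_two, Matrix.cons_val] at hg
  intro h0
  rw [← hg, map_add, map_smul, map_smul] at h0
  have h1 := congrArg (fun x => mink x (A.levelDeriv z w₁)) h0
  have h2 := congrArg (fun x => mink x (A.levelDeriv z w₂)) h0
  simp only [mink_add_left, mink_smul_left, h11, h22, h12, h21, mink_zero_left] at h1 h2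
  apply hv
  rw [← hg, show g 0 = 0 by linarith, show g 1 = 0 by linarith]
  simp

lemma contDiff_normalExp : ContDiff ℝ ∞ A.normalExp := by
  have h1 := A.contDiff_f
  have h2 := A.contDiff_n
  have h3 : ContDiff ℝ ∞ Real.cosh := Real.contDiff_cosh
  have h4 : ContDiff ℝ ∞ Real.sinh := Real.contDiff_sinh
  unfold normalExp hypExp
  exact ((h3.comp contDiff_snd).smul (h1.comp contDiff_fst)).add
    ((h4.comp contDiff_snd).smul (h2.comp contDiff_fst))

lemma hasDerivAt_normalExp {y : ℝ → Plane} {r : ℝ → ℝ} {y' : Plane} {r' s : ℝ}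
    (hy : HasDerivAt y y' s) (hr : HasDerivAt r r' s) :
    HasDerivAt (fun s => A.normalExp (y s, r s))
      (A.levelDeriv (y s, r s) y' + r' • A.normalVel (y s, r s)) s := by
  have h1 : HasDerivAt (fun s => A.f (y s)) (surfDeriv A.f (y s) y') s :=
    (A.hasFDerivAt_f (y s)).comp_hasDerivAt s hy
  have h2 : HasDerivAt (fun s => A.n (y s)) (surfDeriv A.n (y s) y') s :=
    (A.hasFDerivAt_n (y s)).comp_hasDerivAt s hy
  refine ((hr.cosh.smul h1).add (hr.sinh.smul h2)).congr_deriv ?_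
  simp only [levelDeriv_apply, normalVel, hypVel]
  module

lemma hasDerivAt_normalVel {y : ℝ → Plane} {r : ℝ → ℝ} {y' : Plane} {r' s : ℝ}
    (hy : HasDerivAt y y' s) (hr : HasDerivAt r r' s) :
    HasDerivAt (fun s => A.normalVel (y s, r s))
      (A.levelNormalDeriv (y s, r s) y' + r' • A.normalExp (y s, r s)) s := by
  have h1 : HasDerivAt (fun s => A.f (y s)) (surfDeriv A.f (y s) y') s :=
    (A.hasFDerivAt_f (y s)).comp_hasDerivAt s hy
  have h2 : HasDerivAt (fun s => A.n (y s)) (surfDeriv A.n (y s) y') s :=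
    (A.hasFDerivAt_n (y s)).comp_hasDerivAt s hy
  refine ((hr.sinh.smul h1).add (hr.cosh.smul h2)).congr_deriv ?_
  simp only [levelNormalDeriv_apply, normalExp, hypExp]
  module

end AlmostFuchsian

/-! ### A local homeomorphism that lifts rays -/

/-- A path lifts through a local homeomorphism if its partial lifts end in a fixed compact set. -/
lemma IsLocalHomeomorph.exists_lift_of_isCompact {E X : Type*} [TopologicalSpace E]
    [TopologicalSpace X] [FirstCountableTopology E] [T2Space X] {p : E → X}
    (hp : IsLocalHomeomorph p) {γ : ℝ → X} (hγ : Continuous γ) {e₀ : E} (he₀ : p e₀ = γ 0)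
    {C : Set E} (hC : IsCompact C)
    (hlift : ∀ τ ∈ Icc (0 : ℝ) 1, ∀ g : ℝ → E, ContinuousOn g (Icc 0 τ) → g 0 = e₀ →
      (∀ s ∈ Icc 0 τ, p (g s) = γ s) → g τ ∈ C) :
    ∃ g : ℝ → E, ContinuousOn g (Icc 0 1) ∧ g 0 = e₀ ∧ ∀ s ∈ Icc (0 : ℝ) 1, p (g s) = γ s := by
  set J : Set ℝ := {τ | τ ∈ Icc (0 : ℝ) 1 ∧ ∃ g : ℝ → E, ContinuousOn g (Icc 0 τ) ∧ g 0 = e₀ ∧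
    ∀ s ∈ Icc 0 τ, p (g s) = γ s} with hJ
  have h0 : (0 : ℝ) ∈ J := by
    refine ⟨⟨le_rfl, zero_le_one⟩, fun _ => e₀, continuousOn_const, rfl, fun s hs => ?_⟩
    rw [le_antisymm hs.2 hs.1, he₀]
  have hbdd : BddAbove J := ⟨1, fun τ hτ => hτ.1.2⟩
  set σ := sSup J with hσ
  have hσ1 : σ ≤ 1 := csSup_le ⟨0, h0⟩ fun τ hτ => hτ.1.2
  have hσ0 : 0 ≤ σ := le_csSup hbdd h0
  -- Lifts up to times that tend to the supremum, and a limit point of their end points.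
  obtain ⟨τ, -, hτlim, hτ⟩ := exists_seq_tendsto_sSup ⟨0, h0⟩ hbdd
  choose hτ1 g hg hg0 hgγ using hτ
  obtain ⟨q, hq, φ, hφ, hlim⟩ := hC.isSeqCompact (x := fun k => g k (τ k))
    fun k => hlift _ (hτ1 k) _ (hg k) (hg0 k) (hgγ k)
  obtain ⟨e, heq, hpe⟩ := hp q
  have hτφ : Filter.Tendsto (τ ∘ φ) Filter.atTop (nhds σ) := hτlim.comp hφ.tendsto_atTop
  have hpq : p q = γ σ := by
    refine tendsto_nhds_unique ((hp.continuous.tendsto q).comp hlim) ?_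
    have : Filter.Tendsto (fun k => γ ((τ ∘ φ) k)) Filter.atTop (nhds (γ σ)) :=
      (hγ.tendsto σ).comp hτφ
    refine this.congr fun k => ?_
    exact (hgγ (φ k) (τ (φ k)) ⟨(hτ1 _).1, le_rfl⟩).symm
  have hσe : γ σ ∈ e.target := by
    rw [← hpq, hpe]
    exact e.map_source heq
  obtain ⟨ε, hε, hball⟩ := Metric.isOpen_iff.1 (e.open_target.preimage hγ) σ hσe
  obtain ⟨k, hk1, hk2⟩ := ((hlim.eventually_mem (e.open_source.mem_nhds heq)).and
    (hτφ.eventually_mem (Metric.ball_mem_nhds σ hε))).exists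
  simp only [Function.comp_apply, Metric.mem_ball, Real.dist_eq, abs_lt] at hk1 hk2
  have hτσ : τ (φ k) ≤ σ := le_csSup hbdd ⟨hτ1 _, g _, hg _, hg0 _, hgγ _⟩
  -- The lift that ends near the limit point extends beyond the supremum by the local inverse.
  have hext : min 1 (σ + ε / 2) ∈ J := by
    set σ' := min 1 (σ + ε / 2) with hσ'
    have hle : σ ≤ σ' := le_min hσ1 (by linarith)
    have hmem : ∀ s ∈ Icc (τ (φ k)) σ', γ s ∈ e.target := fun s hs => by
      refine hball ?_
      have h2 : s ≤ σ + ε / 2 := hs.2.trans (min_le_right _ _)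
      rw [Metric.mem_ball, Real.dist_eq, abs_lt]
      constructor <;> linarith [hs.1]
    have heqτ : e.symm (γ (τ (φ k))) = g (φ k) (τ (φ k)) := by
      rw [← hgγ (φ k) (τ (φ k)) ⟨(hτ1 _).1, le_rfl⟩, hpe]
      exact e.left_inv hk1
    refine ⟨⟨hσ0.trans hle, min_le_left _ _⟩,
      fun s => if s ≤ τ (φ k) then g (φ k) s else e.symm (γ s), ?_, ?_, ?_⟩
    · have hU : Icc 0 σ' = Icc 0 (τ (φ k)) ∪ Icc (τ (φ k)) σ' :=
        (Icc_union_Icc_eq_Icc (hτ1 _).1 (hτσ.trans hle)).symm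
      rw [hU]
      refine ContinuousOn.union_of_isClosed ?_ ?_ isClosed_Icc isClosed_Icc
      · exact (hg (φ k)).congr fun s hs => if_pos hs.2
      · have h1 : ContinuousOn (fun s => e.symm (γ s)) (Icc (τ (φ k)) σ') :=
          e.continuousOn_symm.comp hγ.continuousOn hmem
        refine h1.congr fun s hs => ?_
        dsimp only
        split_ifs with h
        · rw [le_antisymm h hs.1, heqτ]
        · rfl
    · exact (if_pos (hτ1 _).1).trans (hg0 _)
    · intro s hs
      dsimp only
      split_ifs with h
      · exact hgγ _ _ ⟨hs.1, h⟩
      · rw [hpe]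
        exact e.right_inv (hmem s ⟨(not_le.1 h).le, hs.2⟩)
  have h1 : min 1 (σ + ε / 2) = 1 := by
    refine min_eq_left ?_
    by_contra hlt
    have := le_csSup hbdd hext
    rw [min_eq_right (not_le.1 hlt).le] at this
    linarith
  exact (h1 ▸ hext).2

/-- A local homeomorphism onto a normed space is bijective if all rays from one point of its image
lift: the end points of the lifts form a continuous section, whose image is open and closed. -/
lemma IsLocalHomeomorph.bijective_of_lift {E X : Type*} [TopologicalSpace E] [T2Space E]
    [PreconnectedSpace E] [NormedAddCommGroup X] [NormedSpace ℝ X] {p : E → X}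
    (hp : IsLocalHomeomorph p) (e₀ : E)
    (hlift : ∀ a : X, ∃ g : ℝ → E, ContinuousOn g (Icc 0 1) ∧ g 0 = e₀ ∧
      ∀ s ∈ Icc (0 : ℝ) 1, p (g s) = p e₀ + s • (a - p e₀)) : Function.Bijective p := by
  choose g hg hg0 hgγ using hlift
  have hcont : Continuous fun z : unitInterval × X => g z.2 (z.1 : ℝ) := by
    refine hp.continuous_lift (T2Space.isSeparatedMap p)
      (f := ⟨fun z : unitInterval × X => p e₀ + (z.1 : ℝ) • (z.2 - p e₀), by fun_prop⟩) ?_ ?_ ?_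
    · funext z
      exact hgγ z.2 z.1 z.1.2
    · simp only [Set.Icc.coe_zero, hg0]
      exact continuous_const
    · intro a
      exact continuousOn_iff_continuous_domRestrict.1 (hg a)
  set σ : X → E := fun a => g a 1 with hσ
  have hσc : Continuous σ := hcont.comp (Continuous.prodMk_right (1 : unitInterval))
  have hsec : ∀ a, p (σ a) = a := fun a => by
    rw [hσ, hgγ a 1 ⟨zero_le_one, le_rfl⟩]; simp
  have hclosed : IsClosed (range σ) := by
    have : range σ = {e | σ (p e) = e} := by
      ext e
      constructor
      · rintro ⟨a, rfl⟩
        rw [mem_ofPred_eq, hsec]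
      · intro he
        exact ⟨_, he⟩
    rw [this]
    exact isClosed_eq (hσc.comp hp.continuous) continuous_id
  have hopen : IsOpen (range σ) :=
    (hp.isOpenEmbedding_of_comp (by
      rw [show p ∘ σ = id from funext hsec]
      exact Topology.IsOpenEmbedding.id) hσc).isOpen_range
  have huniv : range σ = univ := by
    rcases isClopen_iff.1 ⟨hclosed, hopen⟩ with h | h
    · exact absurd h (range_nonempty σ).ne_empty
    · exact h
  refine ⟨fun x y hxy => ?_, fun a => ⟨σ a, hsec a⟩⟩
  obtain ⟨a, rfl⟩ := huniv ▸ mem_univ x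
  obtain ⟨b, rfl⟩ := huniv ▸ mem_univ y
  rw [hsec, hsec] at hxy
  rw [hxy]

/-! ### The normal exponential map is a diffeomorphism -/

namespace AlmostFuchsian

variable (A : AlmostFuchsian)

/-- The normal exponential map read in the chart `p ↦ p.2` of `hyp3`. -/
noncomputable def normalExpChart (z : Plane × ℝ) : EuclideanSpace ℝ (Fin 3) := (A.normalExp z).2

lemma contDiff_normalExpChart : ContDiff ℝ ∞ A.normalExpChart :=
  contDiff_snd.comp A.contDiff_normalExp

lemma fderiv_normalExp_apply (z w : Plane × ℝ) :
    fderiv ℝ A.normalExp z w = A.levelDeriv z w.1 + w.2 • A.normalVel z := by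
  have h1 : HasDerivAt (fun s : ℝ => z.1 + s • w.1) w.1 0 := by
    simpa using ((hasDerivAt_id (0 : ℝ)).smul_const w.1).const_add z.1
  have h2 : HasDerivAt (fun s : ℝ => z.2 + s • w.2) w.2 0 := by
    simpa using ((hasDerivAt_id (0 : ℝ)).smul_const w.2).const_add z.2
  have h3 := A.hasDerivAt_normalExp h1 h2
  have h4 : HasDerivAt (fun s : ℝ => A.normalExp (z.1 + s • w.1, z.2 + s • w.2))
      (fderiv ℝ A.normalExp z w) 0 :=
    HasFDerivAt.comp_hasDerivAt (l := A.normalExp) (0 : ℝ) (by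
      simpa using (A.contDiff_normalExp.differentiable (by simp) z).hasFDerivAt) (h1.prodMk h2)
  simpa using h4.unique h3

lemma fderiv_normalExpChart_apply (z w : Plane × ℝ) :
    fderiv ℝ A.normalExpChart z w = (A.levelDeriv z w.1 + w.2 • A.normalVel z).2 := by
  rw [← A.fderiv_normalExp_apply]
  have h := (A.contDiff_normalExp.differentiable (by simp) z).hasFDerivAt
  exact congrArg (fun L : Plane × ℝ →L[ℝ] EuclideanSpace ℝ (Fin 3) => L w)
    ((hasFDerivAt_snd.comp z h).fderiv)

/-- The metric of `hyp3` in the coordinates `(y, r)` has the form `g_r + dr²`. -/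
lemma mink_levelDeriv_add_self (z : Plane × ℝ) (v : Plane) (s : ℝ) :
    mink (A.levelDeriv z v + s • A.normalVel z) (A.levelDeriv z v + s • A.normalVel z) =
      mink (A.levelDeriv z v) (A.levelDeriv z v) + s ^ 2 := by
  simp only [mink_add_left, mink_add_right, mink_smul_left, mink_smul_right,
    mink_comm (A.normalVel z) (A.levelDeriv z v), A.mink_levelDeriv_normalVel,
    A.mink_normalVel_self]
  ring

lemma mink_levelDeriv_nonneg (z : Plane × ℝ) (v : Plane) :
    0 ≤ mink (A.levelDeriv z v) (A.levelDeriv z v) :=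
  mink_self_nonneg (A.normalExp_mem z) (A.mink_levelDeriv_normalExp z v)

lemma sq_le_norm_fderiv (z w : Plane × ℝ) :
    mink (A.levelDeriv z w.1) (A.levelDeriv z w.1) + w.2 ^ 2 ≤
      ‖fderiv ℝ A.normalExpChart z w‖ ^ 2 := by
  rw [fderiv_normalExpChart_apply, ← mink_levelDeriv_add_self]
  exact mink_self_le _

lemma fderiv_normalExpChart_injective (z : Plane × ℝ) :
    Function.Injective (fderiv ℝ A.normalExpChart z) := by
  rw [injective_iff_map_eq_zero]
  intro w hw
  have h1 := A.sq_le_norm_fderiv z w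
  rw [hw, norm_zero] at h1
  have h2 := A.mink_levelDeriv_nonneg z w.1
  refine Prod.ext ?_ ?_
  · by_contra h0
    have := A.mink_levelDeriv_pos z h0
    nlinarith [sq_nonneg w.2]
  · have : w.2 ^ 2 = 0 := by nlinarith [sq_nonneg w.2]
    simpa using this

/-- The differential of the normal exponential map, an isomorphism by
`fderiv_normalExpChart_injective`. -/
noncomputable def normalExpEquiv (z : Plane × ℝ) : (Plane × ℝ) ≃L[ℝ] EuclideanSpace ℝ (Fin 3) :=
  (LinearEquiv.ofInjectiveOfFinrankEq (fderiv ℝ A.normalExpChart z).toLinearMap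
    (A.fderiv_normalExpChart_injective z) (by simp)).toContinuousLinearEquiv

lemma hasFDerivAt_normalExpChart (z : Plane × ℝ) :
    HasFDerivAt A.normalExpChart
      (A.normalExpEquiv z : Plane × ℝ →L[ℝ] EuclideanSpace ℝ (Fin 3)) z := by
  have h := (A.contDiff_normalExpChart.differentiable (by simp) z).hasFDerivAt
  refine h.congr_fderiv ?_
  exact ContinuousLinearMap.ext fun w => rfl

/-- The restriction of the normal exponential map to a neighborhood of `z` on which it is
injective. -/
noncomputable def normalExpLocal (z : Plane × ℝ) :
    OpenPartialHomeomorph (Plane × ℝ) (EuclideanSpace ℝ (Fin 3)) :=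
  (A.contDiff_normalExpChart.contDiffAt (x := z)).toOpenPartialHomeomorph A.normalExpChart
    (A.hasFDerivAt_normalExpChart z) (by simp)

lemma mem_normalExpLocal_source (z : Plane × ℝ) : z ∈ (A.normalExpLocal z).source :=
  ContDiffAt.mem_toOpenPartialHomeomorph_source _ _ _

lemma isLocalHomeomorph_normalExpChart : IsLocalHomeomorph A.normalExpChart :=
  fun z => ⟨A.normalExpLocal z, A.mem_normalExpLocal_source z, rfl⟩

/-- The immersion of the universal covering of `Σ` is proper, because `Γ` acts cocompactly on the
surface and properly discontinuously on `hyp3`. -/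
lemma isCompact_preimage_f {C : Set Mink} (hC : IsCompact C) (hC' : C ⊆ hyp3) :
    IsCompact (A.f ⁻¹' C) := by
  obtain ⟨K, hK, hKc⟩ := A.surface.cocompact
  have hfin := A.kleinian.discontinuous (C ∪ A.f '' K)
    (union_subset hC' (by rintro _ ⟨y, -, rfl⟩; exact A.surface.mem y))
    (hC.union (hK.image A.contDiff_f.continuous))
  have hfin' : {γ : A.Γ | (∃ p ∈ C ∪ A.f '' K, (γ : Mink ≃ₗ[ℝ] Mink) p ∈ C ∪ A.f '' K)}.Finite := by
    refine Set.Finite.of_finite_image (f := Subtype.val) (hfin.subset ?_)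
      Subtype.val_injective.injOn
    rintro _ ⟨γ, hγ, rfl⟩
    exact ⟨γ.2, hγ⟩
  have hcpt := hfin'.isCompact_biUnion (f := fun γ => A.ρ γ⁻¹ '' K)
    fun γ _ => hK.image (A.surface.smooth_action γ⁻¹).continuous
  refine hcpt.of_isClosed_subset (hC.isClosed.preimage A.contDiff_f.continuous) ?_
  intro y hy
  obtain ⟨γ, hγ⟩ := hKc y
  refine mem_biUnion (x := γ) ⟨A.f y, Or.inl hy, Or.inr ⟨_, hγ, A.surface.equivariant γ y⟩⟩
    ⟨_, hγ, ?_⟩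
  rw [map_inv]
  exact (A.ρ γ).symm_apply_apply y

/-- Points of `Σ` within bounded distance of a bounded set are bounded. -/
lemma isCompact_setOf_mink_le (p : Mink) (hp : p ∈ hyp3) (B : ℝ) :
    IsCompact {y | -mink p (A.f y) ≤ B} := by
  set M := (p.1 + ‖p.2‖) * B with hM
  have hC : IsCompact {q : Mink | q ∈ hyp3 ∧ q.1 ≤ M} := by
    have hcl : IsClosed {q : Mink | q ∈ hyp3 ∧ q.1 ≤ M} := by
      have : {q : Mink | q ∈ hyp3 ∧ q.1 ≤ M} =
          {q | mink q q = -1} ∩ ({q | 0 ≤ q.1} ∩ {q | q.1 ≤ M}) := by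
        ext q
        refine ⟨fun h => ⟨h.1.1, h.1.2.le, h.2⟩, fun h => ⟨⟨h.1, ?_⟩, h.2.2⟩⟩
        refine lt_of_le_of_ne h.2.1 fun h0 => ?_
        have h1 : mink q q = -1 := h.1
        simp only [mink, ← h0, real_inner_self_eq_norm_sq] at h1
        nlinarith [sq_nonneg ‖q.2‖]
      rw [this]
      exact (isClosed_eq (continuous_mink continuous_id continuous_id) continuous_const).inter
        ((isClosed_le continuous_const continuous_fst).inter
          (isClosed_le continuous_fst continuous_const))
    refine (isCompact_closedBall (0 : Mink) M).of_isClosed_subset hcl ?_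
    rintro q ⟨hq, hqM⟩
    rw [mem_closedBall_zero_iff, Prod.norm_def]
    refine max_le ?_ ((hyp3_norm_lt hq).le.trans hqM)
    rw [Real.norm_eq_abs, abs_of_pos hq.2]
    exact hqM
  refine (A.isCompact_preimage_f hC fun q hq => hq.1).of_isClosed_subset ?_ ?_
  · exact isClosed_le (continuous_mink continuous_const A.contDiff_f.continuous).neg
      continuous_const
  · intro y hy
    refine ⟨A.surface.mem y, (fst_le_mink hp (A.surface.mem y)).trans ?_⟩
    exact mul_le_mul_of_nonneg_left hy (by linarith [hp.2, norm_nonneg p.2])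

lemma mink_normalExp_f (z : Plane × ℝ) : -mink (A.normalExp z) (A.f z.1) = Real.cosh z.2 := by
  simp only [normalExp, hypExp, mink_add_left, mink_smul_left, (A.surface.mem z.1).1,
    A.surface.tangent]
  ring

/-- Along a lifted ray the height changes at most by the Euclidean length of the ray. -/
lemma abs_snd_sub_le_of_lift {g : ℝ → Plane × ℝ} {τ : ℝ} (hτ : 0 ≤ τ)
    (hg : ContinuousOn g (Icc 0 τ)) {a b : EuclideanSpace ℝ (Fin 3)}
    (hγ : ∀ s ∈ Icc 0 τ, A.normalExpChart (g s) = b + s • a) :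
    |(g τ).2 - (g 0).2| ≤ ‖a‖ * τ := by
  have hd : ∀ s ∈ Icc 0 τ, ∃ w : Plane × ℝ, HasDerivWithinAt g w (Icc 0 τ) s ∧ ‖w.2‖ ≤ ‖a‖ := by
    intro s hs
    set e := A.normalExpLocal (g s) with he
    have hes : g s ∈ e.source := A.mem_normalExpLocal_source _
    have hecoe : (e : Plane × ℝ → _) = A.normalExpChart := rfl
    have hl : HasDerivWithinAt (fun s : ℝ => b + s • a) a (Icc 0 τ) s := by
      simpa using (((hasDerivAt_id s).smul_const a).const_add b).hasDerivWithinAt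
    have hsymm : HasFDerivAt e.symm ((A.normalExpEquiv (g s)).symm : _ →L[ℝ] Plane × ℝ)
        (b + s • a) := by
      have := e.hasFDerivAt_symm (a := b + s • a) (f' := A.normalExpEquiv (g s))
        (by rw [← hγ s hs, ← hecoe]; exact e.map_source hes) (by
          rw [← hγ s hs, ← hecoe, e.left_inv hes]; exact A.hasFDerivAt_normalExpChart (g s))
      exact this
    refine ⟨(A.normalExpEquiv (g s)).symm a, ?_, ?_⟩
    · refine (hsymm.comp_hasDerivWithinAt s hl).congr_of_eventuallyEq ?_ ?_
      · filter_upwards [(hg s hs).eventually_mem (e.open_source.mem_nhds hes), self_mem_nhdsWithin]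
          with t ht ht'
        rw [Function.comp_apply, ← hγ t ht', ← hecoe, e.left_inv ht]
      · rw [Function.comp_apply, ← hγ s hs, ← hecoe, e.left_inv hes]
    · have h1 := A.sq_le_norm_fderiv (g s) ((A.normalExpEquiv (g s)).symm a)
      have h2 : fderiv ℝ A.normalExpChart (g s) ((A.normalExpEquiv (g s)).symm a) = a := by
        rw [(A.hasFDerivAt_normalExpChart (g s)).fderiv]
        exact (A.normalExpEquiv (g s)).apply_symm_apply a
      rw [h2] at h1
      have h3 := A.mink_levelDeriv_nonneg (g s) ((A.normalExpEquiv (g s)).symm a).1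
      rw [Real.norm_eq_abs]
      exact abs_le_of_sq_le_sq (by linarith) (norm_nonneg a)
  choose! w hw hwn using hd
  have h := (convex_Icc (0 : ℝ) τ).norm_image_sub_le_of_norm_hasDerivWithin_le
    (f := fun s => (g s).2) (f' := fun s => (w s).2) (C := ‖a‖)
    (fun s hs => (ContinuousLinearMap.snd ℝ Plane ℝ).hasFDerivAt.comp_hasDerivWithinAt s (hw s hs))
    hwn
    (left_mem_Icc.2 hτ) (right_mem_Icc.2 hτ)
  simpa [abs_of_nonneg hτ] using h

theorem normalExpChart_bijective : Function.Bijective A.normalExpChart := by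
  refine A.isLocalHomeomorph_normalExpChart.bijective_of_lift (0, 0) fun a => ?_
  set b := A.normalExpChart (0, 0) with hb
  set R := ‖a - b‖ with hR
  set P := A.normalExp (0, 0) with hP
  set B := ‖b‖ + R with hB
  -- The partial lifts stay at bounded height over a compact part of the surface.
  set C : Set (Plane × ℝ) := {y | -mink (1, 0) (A.f y) ≤ 2 * √(1 + B ^ 2) * Real.cosh R} ×ˢ
    Icc (-R) R with hC
  have h10 : ((1, 0) : Mink) ∈ hyp3 := by constructor <;> simp [mink]
  refine A.isLocalHomeomorph_normalExpChart.exists_lift_of_isCompact (by fun_prop) (by simp [hb])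
    (C := C) ((A.isCompact_setOf_mink_le _ h10 _).prod isCompact_Icc) fun τ hτ g hg hg0 hγ => ?_
  have h1 := A.abs_snd_sub_le_of_lift hτ.1 hg hγ
  rw [hg0, sub_zero] at h1
  have h2 : |(g τ).2| ≤ R := h1.trans (mul_le_of_le_one_right (norm_nonneg _) hτ.2)
  refine ⟨?_, abs_le.1 h2⟩
  have hmem := A.normalExp_mem (g τ)
  have hn : ‖(A.normalExp (g τ)).2‖ ≤ B := by
    have h3 : (A.normalExp (g τ)).2 = b + τ • (a - b) := hγ τ ⟨hτ.1, le_rfl⟩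
    rw [h3]
    refine (norm_add_le _ _).trans (add_le_add le_rfl ?_)
    rw [norm_smul, Real.norm_eq_abs, abs_of_nonneg hτ.1]
    exact mul_le_of_le_one_left (norm_nonneg _) hτ.2
  have h4 := fst_le_mink hmem (A.surface.mem (g τ).1)
  rw [mink_normalExp_f] at h4
  have h5 : (A.normalExp (g τ)).1 ≤ √(1 + B ^ 2) := by
    refine Real.le_sqrt_of_sq_le ?_
    rw [hyp3_fst_sq hmem]
    have := pow_le_pow_left₀ (norm_nonneg _) hn 2
    linarith
  have h6 := hyp3_norm_lt hmem
  have h7 : Real.cosh (g τ).2 ≤ Real.cosh R := by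
    rw [Real.cosh_le_cosh]
    exact h2.trans (le_abs_self R)
  have h8 : -mink (1, 0) (A.f (g τ).1) = (A.f (g τ).1).1 := by simp [mink]
  rw [mem_ofPred_eq, h8]
  refine h4.trans (mul_le_mul (by linarith) h7 (Real.cosh_pos _).le (by positivity))

/-- The inverse of the normal exponential map, in the chart `p ↦ p.2` of `hyp3`: the coordinates
`(y, r)` of a point. -/
noncomputable def fermi : EuclideanSpace ℝ (Fin 3) → Plane × ℝ :=
  (Equiv.ofBijective _ A.normalExpChart_bijective).symm

lemma normalExpChart_fermi (a : EuclideanSpace ℝ (Fin 3)) : A.normalExpChart (A.fermi a) = a :=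
  (Equiv.ofBijective _ A.normalExpChart_bijective).apply_symm_apply a

lemma fermi_normalExp (z : Plane × ℝ) : A.fermi (A.normalExp z).2 = z :=
  (Equiv.ofBijective _ A.normalExpChart_bijective).symm_apply_apply z

lemma normalExp_fermi {p : Mink} (hp : p ∈ hyp3) : A.normalExp (A.fermi p.2) = p :=
  hyp3_ext (A.normalExp_mem _) hp (A.normalExpChart_fermi p.2)

lemma normalExp_injective : Function.Injective A.normalExp := fun z w h => by
  rw [← A.fermi_normalExp z, h, A.fermi_normalExp]

lemma contDiff_fermi : ContDiff ℝ ∞ A.fermi := by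
  rw [contDiff_iff_contDiffAt]
  intro a
  have hloc := (A.contDiff_normalExpChart.contDiffAt (x := A.fermi a)).to_localInverse
    (A.hasFDerivAt_normalExpChart (A.fermi a)) (by simp)
  rw [normalExpChart_fermi] at hloc
  refine hloc.congr_of_eventuallyEq ?_
  set e := A.normalExpLocal (A.fermi a) with he
  have het : a ∈ e.target := by
    have := e.map_source (A.mem_normalExpLocal_source (A.fermi a))
    rwa [show e (A.fermi a) = a from A.normalExpChart_fermi a] at this
  filter_upwards [e.open_target.mem_nhds het] with b hb
  refine A.normalExpChart_bijective.injective ?_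
  rw [normalExpChart_fermi]
  exact (e.right_inv hb).symm

end AlmostFuchsian

/-! ### The height function -/

namespace AlmostFuchsian

variable (A : AlmostFuchsian)

/-- The point of `Σ` closest to `normalExp z` is the foot point `z.1`. A closest point exists
because the immersion is proper, and the geodesic from it is normal to `Σ`. -/
lemma cosh_le_mink (z : Plane × ℝ) (x : Plane) : Real.cosh z.2 ≤ -mink (A.normalExp z) (A.f x) := by
  set p := A.normalExp z with hp
  have hpm : p ∈ hyp3 := A.normalExp_mem z
  have hcont : Continuous fun x => -mink p (A.f x) :=
    (continuous_mink continuous_const A.contDiff_f.continuous).neg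
  obtain ⟨x₁, hx₁, hmin⟩ := (A.isCompact_setOf_mink_le p hpm (-mink p (A.f z.1))).exists_isMinOn
    ⟨z.1, le_refl (-mink p (A.f z.1))⟩ hcont.continuousOn
  have hmin' : ∀ x, -mink p (A.f x₁) ≤ -mink p (A.f x) := fun x => by
    by_cases h : -mink p (A.f x) ≤ -mink p (A.f z.1)
    · exact hmin h
    · exact (show -mink p (A.f x₁) ≤ _ from hx₁).trans (not_le.1 h).le
  have hcrit : ∀ v, mink p (surfDeriv A.f x₁ v) = 0 := by
    intro v
    have hl : HasDerivAt (fun s : ℝ => x₁ + s • v) v 0 := by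
      simpa using ((hasDerivAt_id (0 : ℝ)).smul_const v).const_add x₁
    have h1 : HasDerivAt (fun s : ℝ => A.f (x₁ + s • v)) (surfDeriv A.f x₁ v) 0 :=
      HasFDerivAt.comp_hasDerivAt (0 : ℝ) (by simpa using A.hasFDerivAt_f x₁) hl
    have h2 := ((hasDerivAt_const (0 : ℝ) p).mink h1).neg
    have h3 : IsLocalMin (fun s : ℝ => -mink p (A.f (x₁ + s • v))) 0 :=
      Filter.Eventually.of_forall fun s => by
        simpa using hmin' (x₁ + s • v)
    have := h3.hasDerivAt_eq_zero h2
    rw [mink_zero_left] at this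
    linarith
  have h0 : A.normalExp (x₁, 0) = A.f x₁ := by simp [normalExp, hypExp]
  have h0' : A.normalVel (x₁, 0) = A.n x₁ := by simp [normalVel, hypVel]
  have hff : mink (A.f x₁) (A.f x₁) = -1 := (A.surface.mem x₁).1
  set φ := -mink p (A.f x₁) with hφ
  obtain ⟨w, hw⟩ := A.exists_levelDeriv_add (z := (x₁, 0)) (v := p - φ • A.f x₁) (by
    rw [h0, mink_sub_left, mink_smul_left, hff]; ring)
  rw [h0', mink_sub_left, mink_smul_left, mink_comm (A.f x₁), A.surface.tangent, mul_zero, sub_zero]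
    at hw
  have hLw : A.levelDeriv (x₁, 0) w = surfDeriv A.f x₁ w := by simp [levelDeriv_apply]
  have hw0 : w = 0 := by
    by_contra hne
    have h1 := A.mink_levelDeriv_pos (x₁, 0) hne
    have h2 : mink (A.levelDeriv (x₁, 0) w) (surfDeriv A.f x₁ w) = 0 := by
      rw [← sub_eq_iff_eq_add.2 hw, mink_sub_left, mink_sub_left, mink_smul_left, mink_smul_left,
        hcrit, mink_comm (A.f x₁), A.surface.mink_deriv_self, A.surface.normal]
      ring
    rw [hLw] at h1 h2
    exact h1.ne' h2
  rw [hw0, map_zero, zero_add, sub_eq_iff_eq_add] at hw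
  set q := mink p (A.n x₁) with hq
  have hpp : φ ^ 2 = 1 + q ^ 2 := by
    have h1 := hpm.1
    rw [hw] at h1
    simp only [mink_add_left, mink_add_right, mink_smul_left, mink_smul_right, hff, A.surface.unit,
      A.surface.tangent, mink_comm (A.f x₁) (A.n x₁)] at h1
    linarith
  have hφ0 : 0 < φ := by
    have h1 := fst_le_mink hpm (A.surface.mem x₁)
    have h2 := (A.surface.mem x₁).2
    have h3 := hpm.2
    by_contra hneg
    have : (p.1 + ‖p.2‖) * φ ≤ 0 :=
      mul_nonpos_of_nonneg_of_nonpos (by positivity) (not_lt.1 hneg)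
    linarith
  have hcosh : Real.cosh (Real.arsinh q) = φ := by
    rw [Real.cosh_arsinh, ← hpp, Real.sqrt_sq hφ0.le]
  have hexp : A.normalExp (x₁, Real.arsinh q) = p := by
    rw [hw, normalExp, hypExp, hcosh, Real.sinh_arsinh, add_comm]
  have hz := A.normalExp_injective hexp
  calc Real.cosh z.2 = φ := by rw [← hz, hcosh]
    _ ≤ _ := hmin' x

lemma distSurf_normalExp (z : Plane × ℝ) : A.distSurf (A.normalExp z) = |z.2| := by
  have h0 : ∀ x, |z.2| ≤ hypDist (A.normalExp z) (A.f x) := fun x => by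
    rw [hypDist, ← Real.arcosh_cosh (abs_nonneg z.2), Real.cosh_abs]
    have h1 := A.cosh_le_mink z x
    exact (Real.arcosh_le_arcosh (Real.cosh_pos _) ((Real.cosh_pos _).trans_le h1)).2 h1
  have h1 : hypDist (A.normalExp z) (A.f z.1) = |z.2| := by
    rw [hypDist, mink_normalExp_f, ← Real.cosh_abs, Real.arcosh_cosh (abs_nonneg z.2)]
  refine le_antisymm ?_ (le_ciInf h0)
  rw [← h1]
  refine ciInf_le ⟨|z.2|, ?_⟩ z.1
  rintro _ ⟨x, rfl⟩
  exact h0 x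

lemma height_normalExp (z : Plane × ℝ) : A.height (A.normalExp z) = z.2 := by
  rw [height, distSurf_normalExp]
  split_ifs with h
  · obtain ⟨x, hx⟩ := h
    have := A.normalExp_injective (a₁ := z) (a₂ := (x, |z.2|)) hx
    rw [this]
    exact abs_abs _
  · rw [abs_of_neg, neg_neg]
    by_contra hneg
    exact h ⟨z.1, by rw [abs_of_nonneg (not_lt.1 hneg)]; rfl⟩

lemma height_eq {p : Mink} (hp : p ∈ hyp3) : A.height p = (A.fermi p.2).2 := by
  conv_lhs => rw [← A.normalExp_fermi hp]
  exact A.height_normalExp _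

lemma normalExp_smul (γ : A.Γ) (y : Plane) (r : ℝ) :
    A.normalExp (A.ρ γ y, r) = (γ : Mink ≃ₗ[ℝ] Mink) (A.normalExp (y, r)) := by
  simp only [normalExp, hypExp, map_add, map_smul, A.surface.equivariant,
    A.surface.equivariant_normal]

lemma height_smul (γ : A.Γ) {p : Mink} (hp : p ∈ hyp3) :
    A.height ((γ : Mink ≃ₗ[ℝ] Mink) p) = A.height p := by
  obtain ⟨z, rfl⟩ : ∃ z, A.normalExp z = p := ⟨_, A.normalExp_fermi hp⟩
  rw [← normalExp_smul, height_normalExp, height_normalExp]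

/-- The slabs of `M` are compact: a slab is the image of a product of an interval with a compact
fundamental domain of `Σ`. -/
lemma isCompact_slab (α β : ℝ) : IsCompact (A.slab α β) := by
  obtain ⟨K, hK, hKc⟩ := A.surface.cocompact
  have hcont : Continuous fun z : Plane × ℝ =>
      (Quotient.mk A.orbitSetoid ⟨A.normalExp z, A.normalExp_mem z⟩ : A.Manifold) :=
    continuous_quotient_mk'.comp (A.contDiff_normalExp.continuous.subtype_mk _)
  have h := (hK.prod (isCompact_Icc (a := α) (b := β))).image hcont
  convert h using 1
  ext m
  constructor
  · rintro ⟨p, rfl, hp⟩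
    obtain ⟨γ, hγ⟩ := hKc (A.fermi (p : Mink).2).1
    rw [A.height_eq p.2] at hp
    refine ⟨(A.ρ γ (A.fermi (p : Mink).2).1, (A.fermi (p : Mink).2).2), ⟨hγ, hp⟩, ?_⟩
    refine Quotient.sound (s := A.orbitSetoid) ((A.orbitSetoid).symm ⟨γ, γ.2, ?_⟩)
    exact ((A.normalExp_smul γ _ _).trans (by rw [Prod.mk.eta, A.normalExp_fermi p.2])).symm
  · rintro ⟨z, ⟨-, hz⟩, rfl⟩
    exact ⟨_, rfl, by rwa [height_normalExp]⟩

end AlmostFuchsian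

/-! ### Comparison with the equidistant surfaces at critical points of the height -/

lemma ContDiffAt.hasDerivAt_deriv {E : Type*} [NormedAddCommGroup E] [NormedSpace ℝ E] {a : ℝ → E}
    {s : ℝ} (ha : ContDiffAt ℝ ∞ a s) : HasDerivAt (deriv a) (deriv (deriv a) s) s := by
  have h1 : ContDiffAt ℝ ∞ (fderiv ℝ a) s := ha.fderiv_right (by simp)
  have h2 : DifferentiableAt ℝ (fun s => fderiv ℝ a s 1) s :=
    (h1.differentiableAt (by simp)).clm_apply (differentiableAt_const _)
  exact (show DifferentiableAt ℝ (deriv a) s from h2).hasDerivAt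

/-- The necessary second order condition at a local minimum. -/
lemma IsLocalMin.deriv_deriv_nonneg {u : ℝ → ℝ} {s : ℝ} (h : IsLocalMin u s)
    (hu : ContinuousAt u s) : 0 ≤ deriv (deriv u) s := by
  by_contra hneg
  -- With a negative second derivative the function would also have a local maximum.
  have hd : deriv (fun x => -u x) = fun x => -deriv u x := by
    funext x; exact deriv.fun_neg
  have h1 : IsLocalMin (fun x => -u x) s := by
    refine isLocalMin_of_deriv_deriv_pos ?_ ?_ hu.neg
    · rw [hd, deriv.fun_neg]; linarith
    · rw [hd]; simp [h.deriv_eq_zero]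
  have h2 : u =ᶠ[nhds s] fun _ => u s := by
    filter_upwards [h, h1] with x hx hx'
    linarith
  rw [h2.deriv.deriv_eq] at hneg
  simp at hneg

namespace AlmostFuchsian

variable (A : AlmostFuchsian)

/-- The mean curvature at distance `r` from a point of `Σ` with principal curvatures `±√m`, of the
surface that is equidistant to `Σ`. -/
noncomputable def levelMeanCurv (r m : ℝ) : ℝ :=
  2 * Real.sinh r * Real.cosh r * (1 - m) / (Real.cosh r ^ 2 - Real.sinh r ^ 2 * m)

lemma fderiv_fermi_normalVel (z : Plane × ℝ) :
    (fderiv ℝ A.fermi (A.normalExp z).2 (A.normalVel z).2).2 = 1 := by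
  have h1 := A.hasDerivAt_normalExp (hasDerivAt_const z.2 z.1) (hasDerivAt_id z.2)
  have h2 := (ContinuousLinearMap.snd ℝ ℝ
    (EuclideanSpace ℝ (Fin 3))).hasFDerivAt.comp_hasDerivAt _ h1
  have h3 := (A.contDiff_fermi.differentiable (by simp) (A.normalExp z).2).hasFDerivAt
  have h4 := (ContinuousLinearMap.snd ℝ Plane ℝ).hasFDerivAt.comp_hasDerivAt _
    (HasFDerivAt.comp_hasDerivAt (l := A.fermi) z.2 h3 h2)
  have h5 : (ContinuousLinearMap.snd ℝ Plane ℝ) ∘ A.fermi ∘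
      (ContinuousLinearMap.snd ℝ ℝ (EuclideanSpace ℝ (Fin 3))) ∘
      (fun s => A.normalExp (z.1, id s)) = id := by
    funext s
    exact congrArg Prod.snd (A.fermi_normalExp (z.1, s))
  rw [h5] at h4
  simpa using h4.unique (hasDerivAt_id z.2)

variable {S : Type*} [TopologicalSpace S] [ChartedSpace Plane S] {ρ : A.Γ →* Equiv.Perm S}
  {F ν : S → Mink}

variable {A}

/-- The Fermi coordinates of the immersion along a coordinate line. -/
lemma hasDerivAt_fermi_coordLine (h : IsClosedSurface A.Γ ρ F ν) (x : S) (v : Plane) :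
    HasDerivAt (fun s => A.fermi (F (coordLine x v s)).2)
      (fderiv ℝ A.fermi (F x).2 (surfDeriv F x v).2) 0 := by
  have h2 := (ContinuousLinearMap.snd ℝ ℝ (EuclideanSpace ℝ (Fin 3))).hasFDerivAt.comp_hasDerivAt _
    (h.hasDerivAt_map x v)
  refine HasFDerivAt.comp_hasDerivAt (l := A.fermi) 0 ?_ h2
  simpa [coordLine_zero] using (A.contDiff_fermi.differentiable (by simp) (F x).2).hasFDerivAt

lemma hasDerivAt_height_coordLine (h : IsClosedSurface A.Γ ρ F ν) (x : S) (v : Plane) :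
    HasDerivAt (fun s => A.height (F (coordLine x v s)))
      (fderiv ℝ A.fermi (F x).2 (surfDeriv F x v).2).2 0 := by
  have h1 := (ContinuousLinearMap.snd ℝ Plane ℝ).hasFDerivAt.comp_hasDerivAt _
    (hasDerivAt_fermi_coordLine h x v)
  refine h1.congr_of_eventuallyEq (Filter.Eventually.of_forall fun s => ?_)
  exact A.height_eq (h.mem _)

/-- The splitting of `dF` into its parts tangent and normal to the equidistant surface. -/
lemma surfDeriv_eq_levelDeriv_add (h : IsClosedSurface A.Γ ρ F ν) (x : S) (v : Plane) :
    surfDeriv F x v =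
      A.levelDeriv (A.fermi (F x).2) (fderiv ℝ A.fermi (F x).2 (surfDeriv F x v).2).1 +
      (fderiv ℝ A.fermi (F x).2 (surfDeriv F x v).2).2 • A.normalVel (A.fermi (F x).2) := by
  have h1 := hasDerivAt_fermi_coordLine h x v
  have h2 := (ContinuousLinearMap.fst ℝ Plane ℝ).hasFDerivAt.comp_hasDerivAt _ h1
  have h3 := (ContinuousLinearMap.snd ℝ Plane ℝ).hasFDerivAt.comp_hasDerivAt _ h1
  have h4 := A.hasDerivAt_normalExp h2 h3
  have h5 := h.hasDerivAt_map x v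
  have h6 : (fun s => F (coordLine x v s)) = fun s => A.normalExp
      (((ContinuousLinearMap.fst ℝ Plane ℝ) ∘ fun s => A.fermi (F (coordLine x v s)).2) s,
        ((ContinuousLinearMap.snd ℝ Plane ℝ) ∘ fun s => A.fermi (F (coordLine x v s)).2) s) := by
    funext s
    exact (A.normalExp_fermi (h.mem _)).symm
  rw [h6] at h5
  have h7 := h5.unique h4
  simpa [coordLine_zero] using h7

/-- A point of the surface is critical for the height, which is the second of the Fermi
coordinates. -/
def IsHeightCritical (A : AlmostFuchsian) (F : S → Mink) (x : S) : Prop :=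
  ∀ v : Plane, (fderiv ℝ A.fermi (F x).2 (surfDeriv F x v).2).2 = 0

/-- The differential of the projection of the surface to `Σ`. -/
noncomputable def footDeriv (A : AlmostFuchsian) (F : S → Mink) (x : S) : Plane →L[ℝ] Plane :=
  (ContinuousLinearMap.fst ℝ Plane ℝ).comp ((fderiv ℝ A.fermi (F x).2).comp
    ((ContinuousLinearMap.snd ℝ ℝ (EuclideanSpace ℝ (Fin 3))).comp (surfDeriv F x)))

lemma IsHeightCritical.surfDeriv_eq {x : S} (hx : IsHeightCritical A F x)
    (h : IsClosedSurface A.Γ ρ F ν) (v : Plane) :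
    surfDeriv F x v = A.levelDeriv (A.fermi (F x).2) (footDeriv A F x v) := by
  have := surfDeriv_eq_levelDeriv_add h x v
  rw [hx v, zero_smul, add_zero] at this
  exact this

lemma IsHeightCritical.footDeriv_surjective {x : S} (hx : IsHeightCritical A F x)
    (h : IsClosedSurface A.Γ ρ F ν) : Function.Surjective (footDeriv A F x) := by
  have hinj : Function.Injective (footDeriv A F x) := by
    rw [injective_iff_map_eq_zero]
    intro v hv
    refine h.immersion x ?_
    rw [hx.surfDeriv_eq h, hv, map_zero, map_zero]
  exact (LinearMap.injective_iff_surjective (f := (footDeriv A F x : Plane →ₗ[ℝ] Plane))).1 hinj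

/-- At a critical point of the height the surface is tangent to an equidistant surface, and the
angle condition selects the sign of the normal. -/
lemma IsHeightCritical.normal_eq {x : S} (hx : IsHeightCritical A F x)
    (h : IsClosedSurface A.Γ ρ F ν) (hangle : A.AngleNonneg (F x) (ν x)) :
    ν x = A.normalVel (A.fermi (F x).2) := by
  set z := A.fermi (F x).2 with hz
  have hexp : A.normalExp z = F x := A.normalExp_fermi (h.mem x)
  obtain ⟨w, hw⟩ := A.exists_levelDeriv_add (z := z) (v := ν x) (by rw [hexp]; exact h.tangent x)
  have hθ : 0 ≤ mink (ν x) (A.normalVel z) := hangle z.1 z.2 hexp.symm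
  set θ := mink (ν x) (A.normalVel z)
  obtain ⟨v, hv⟩ := hx.footDeriv_surjective h w
  have hw0 : w = 0 := by
    by_contra hne
    have h1 := A.mink_levelDeriv_pos z hne
    have h2 := h.normal x v
    rw [hx.surfDeriv_eq h, hv, ← hz, hw, mink_add_left, mink_smul_left,
      mink_comm (A.normalVel z), A.mink_levelDeriv_normalVel] at h2
    linarith
  rw [hw0, map_zero, zero_add] at hw
  have h3 := h.unit x
  rw [hw, mink_smul_left, mink_smul_right, A.mink_normalVel_self] at h3
  have h4 : θ = 1 := by nlinarith
  rw [hw, h4, one_smul]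

variable [IsManifold (𝓡 2) ∞ S]

/-- The second fundamental form at a critical point of the height `u` is that of the tangent
equidistant surface minus the Hessian of `u`. -/
lemma IsHeightCritical.secondForm_eq {x : S} (hx : IsHeightCritical A F x)
    (h : IsClosedSurface A.Γ ρ F ν) (hangle : A.AngleNonneg (F x) (ν x)) (v : Plane) :
    mink (surfDeriv ν x v) (surfDeriv F x v) =
      mink (A.levelNormalDeriv (A.fermi (F x).2) (footDeriv A F x v))
        (A.levelDeriv (A.fermi (F x).2) (footDeriv A F x v)) -
      deriv (deriv fun s => A.height (F (coordLine x v s))) 0 := by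
  have hev := eventually_coordLine x v
  have ha : ∀ᶠ s in nhds (0 : ℝ), ContDiffAt ℝ ∞ (fun s => F (coordLine x v s)) s :=
    hev.mono fun s hs => contDiffAt_comp_coordLine h.smooth hs
  have ha0 := h.hasDerivAt_map x v
  have haa := ha.self_of_nhds.hasDerivAt_deriv
  have hq0 := hasDerivAt_fermi_coordLine h x v
  -- Differentiate `⟨ν, ∂F⟩ = 0`.
  have e1 : mink (surfDeriv ν x v) (surfDeriv F x v) +
      mink (ν x) (deriv (deriv fun s => F (coordLine x v s)) 0) = 0 := by
    have h1 := (h.hasDerivAt_normal x v).mink haa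
    have h2 : (fun s => mink (ν (coordLine x v s)) (deriv (fun s => F (coordLine x v s)) s))
        =ᶠ[nhds 0] fun _ => 0 := by
      filter_upwards [hev] with s hs
      obtain ⟨w, hw⟩ := exists_hasDerivAt_coordLine hs
      rw [(hw F h.smooth).deriv, h.normal]
    have h3 := (h1.congr_of_eventuallyEq h2.symm).unique (hasDerivAt_const (0 : ℝ) (0 : ℝ))
    rwa [ha0.deriv, coordLine_zero] at h3
  -- Differentiate `⟨∂/∂r, ∂F⟩ = ∂u`.
  have e2 : mink (A.levelNormalDeriv (A.fermi (F x).2) (footDeriv A F x v)) (surfDeriv F x v) +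
      mink (A.normalVel (A.fermi (F x).2)) (deriv (deriv fun s => F (coordLine x v s)) 0) =
      deriv (deriv fun s => A.height (F (coordLine x v s))) 0 := by
    have h2 := (ContinuousLinearMap.fst ℝ Plane ℝ).hasFDerivAt.comp_hasDerivAt _ hq0
    have h3 := (ContinuousLinearMap.snd ℝ Plane ℝ).hasFDerivAt.comp_hasDerivAt _ hq0
    have h4 := (A.hasDerivAt_normalVel h2 h3).mink haa
    have h5 : (fun s => mink (A.normalVel
        (((ContinuousLinearMap.fst ℝ Plane ℝ) ∘ fun s => A.fermi (F (coordLine x v s)).2) s,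
        ((ContinuousLinearMap.snd ℝ Plane ℝ) ∘ fun s => A.fermi (F (coordLine x v s)).2) s))
        (deriv (fun s => F (coordLine x v s)) s))
        =ᶠ[nhds 0] deriv fun s => A.height (F (coordLine x v s)) := by
      filter_upwards [ha] with s hs
      have k1 : HasDerivAt (fun s => A.fermi (F (coordLine x v s)).2)
          (deriv (fun s => A.fermi (F (coordLine x v s)).2) s) s := by
        refine DifferentiableAt.hasDerivAt ?_
        exact (A.contDiff_fermi.differentiable (by simp) _).comp s
          ((hs.differentiableAt (by simp)).snd)
      have k2 := (ContinuousLinearMap.fst ℝ Plane ℝ).hasFDerivAt.comp_hasDerivAt _ k1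
      have k3 := (ContinuousLinearMap.snd ℝ Plane ℝ).hasFDerivAt.comp_hasDerivAt _ k1
      have k4 := A.hasDerivAt_normalExp k2 k3
      have k5 : (fun s => F (coordLine x v s)) = fun s => A.normalExp
          (((ContinuousLinearMap.fst ℝ Plane ℝ) ∘ fun s => A.fermi (F (coordLine x v s)).2) s,
          ((ContinuousLinearMap.snd ℝ Plane ℝ) ∘ fun s => A.fermi (F (coordLine x v s)).2) s) := by
        funext s
        exact (A.normalExp_fermi (h.mem _)).symm
      have k6 : (fun s => A.height (F (coordLine x v s))) =
          (ContinuousLinearMap.snd ℝ Plane ℝ) ∘ fun s => A.fermi (F (coordLine x v s)).2 :=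
        funext fun s => A.height_eq (h.mem _)
      rw [← k5] at k4
      rw [k4.deriv, k6, k3.deriv, mink_add_right, mink_smul_right, A.mink_normalVel_self,
        mink_comm, A.mink_levelDeriv_normalVel]
      ring
    have h6 := (h4.congr_of_eventuallyEq h5.symm).deriv
    rw [h6, ha0.deriv]
    simp only [Function.comp_apply, ContinuousLinearMap.coe_fst', ContinuousLinearMap.coe_snd',
      coordLine_zero, Prod.mk.eta, hx v, zero_smul, add_zero]
    rfl
  rw [hx.normal_eq h hangle] at e1
  rw [hx.surfDeriv_eq h v] at e1 e2 ⊢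
  linarith

/-- The trace of `IsHeightCritical.secondForm_eq` over an orthonormal basis. -/
lemma IsHeightCritical.surfMeanCurv_eq {x : S} (hx : IsHeightCritical A F x)
    (h : IsClosedSurface A.Γ ρ F ν) (hangle : A.AngleNonneg (F x) (ν x)) :
    ∃ (v₁ v₂ : Plane) (m : ℝ), 0 ≤ m ∧ m < 1 ∧ √m ∈ A.principalCurvs ∧
      surfMeanCurv F ν x = levelMeanCurv (A.height (F x)) m -
        (deriv (deriv fun s => A.height (F (coordLine x v₁ s))) 0 +
          deriv (deriv fun s => A.height (F (coordLine x v₂ s))) 0) := by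
  obtain ⟨w₁, w₂, m, hm0, hm1, hp, h11, h22, h12, hH⟩ := A.exists_levelFrame (A.fermi (F x).2)
  obtain ⟨v₁, rfl⟩ := hx.footDeriv_surjective h w₁
  obtain ⟨v₂, rfl⟩ := hx.footDeriv_surjective h w₂
  refine ⟨v₁, v₂, m, hm0, hm1, ⟨_, hp⟩, ?_⟩
  rw [← hx.surfDeriv_eq h] at h11 h12 h22
  rw [← hx.surfDeriv_eq h] at h12
  rw [surfMeanCurv, meanCurv_eq h11 h22 h12, hx.secondForm_eq h hangle, hx.secondForm_eq h hangle,
    A.height_eq (h.mem x), levelMeanCurv, ← hH]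
  ring

omit [IsManifold (𝓡 2) ∞ S] in
lemma isHeightCritical_of_isLocalExtr {x : S} (h : IsClosedSurface A.Γ ρ F ν)
    (hx : ∀ v, IsLocalExtr (fun s => A.height (F (coordLine x v s))) 0) :
    IsHeightCritical A F x :=
  fun v => (hx v).hasDerivAt_eq_zero (hasDerivAt_height_coordLine h x v)

/-- At a lowest point the mean curvature is at most that of the equidistant surface. -/
lemma exists_surfMeanCurv_le {x : S} (h : IsClosedSurface A.Γ ρ F ν)
    (hangle : A.AngleNonneg (F x) (ν x)) (hmin : ∀ y, A.height (F x) ≤ A.height (F y)) :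
    IsHeightCritical A F x ∧ ∃ m, 0 ≤ m ∧ m < 1 ∧ √m ∈ A.principalCurvs ∧
      surfMeanCurv F ν x ≤ levelMeanCurv (A.height (F x)) m := by
  have hloc : ∀ v, IsLocalMin (fun s => A.height (F (coordLine x v s))) 0 := fun v =>
    Filter.Eventually.of_forall fun s => by simpa only [coordLine_zero] using hmin _
  have hx := isHeightCritical_of_isLocalExtr h fun v => Or.inl (hloc v)
  obtain ⟨v₁, v₂, m, hm0, hm1, hp, hH⟩ := hx.surfMeanCurv_eq h hangle
  have h1 := (hloc v₁).deriv_deriv_nonneg (hasDerivAt_height_coordLine h x v₁).continuousAt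
  have h2 := (hloc v₂).deriv_deriv_nonneg (hasDerivAt_height_coordLine h x v₂).continuousAt
  exact ⟨hx, m, hm0, hm1, hp, by linarith⟩

/-- At a highest point the mean curvature is at least that of the equidistant surface. -/
lemma exists_le_surfMeanCurv {x : S} (h : IsClosedSurface A.Γ ρ F ν)
    (hangle : A.AngleNonneg (F x) (ν x)) (hmax : ∀ y, A.height (F y) ≤ A.height (F x)) :
    IsHeightCritical A F x ∧ ∃ m, 0 ≤ m ∧ m < 1 ∧ √m ∈ A.principalCurvs ∧
      levelMeanCurv (A.height (F x)) m ≤ surfMeanCurv F ν x := by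
  have hloc : ∀ v, IsLocalMax (fun s => A.height (F (coordLine x v s))) 0 := fun v =>
    Filter.Eventually.of_forall fun s => by simpa only [coordLine_zero] using hmax _
  have hx := isHeightCritical_of_isLocalExtr h fun v => Or.inr (hloc v)
  obtain ⟨v₁, v₂, m, hm0, hm1, hp, hH⟩ := hx.surfMeanCurv_eq h hangle
  have key : ∀ v, deriv (deriv fun s => A.height (F (coordLine x v s))) 0 ≤ 0 := fun v => by
    have h1 := (hloc v).neg.deriv_deriv_nonneg
      (hasDerivAt_height_coordLine h x v).continuousAt.neg
    have hd : deriv (fun s => -A.height (F (coordLine x v s))) =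
        fun s => -deriv (fun s => A.height (F (coordLine x v s))) s := by
      funext s; exact deriv.fun_neg
    rw [hd, deriv.fun_neg] at h1
    linarith
  exact ⟨hx, m, hm0, hm1, hp, by linarith [key v₁, key v₂]⟩

omit [IsManifold (𝓡 2) ∞ S] in
/-- The height of a critical point moves with speed `c - H`. -/
lemma hasDerivWithinAt_height {c T : ℝ} {F ν : ℝ → S → Mink} (hF : IsMMCF A.Γ ρ c T F ν) {t : ℝ}
    (ht : t ∈ Icc 0 T) {x : S} (hx : IsHeightCritical A (F t) x)
    (hangle : A.AngleNonneg (F t x) (ν t x)) :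
    HasDerivWithinAt (fun s => A.height (F s x)) (c - surfMeanCurv (F t) (ν t) x) (Icc 0 T) t := by
  have h2 := (ContinuousLinearMap.snd ℝ ℝ
    (EuclideanSpace ℝ (Fin 3))).hasFDerivAt.comp_hasDerivWithinAt _ (hF.flow t ht x)
  have h3 := (A.contDiff_fermi.differentiable (by simp) (F t x).2).hasFDerivAt
  have h4 := (ContinuousLinearMap.snd ℝ Plane ℝ).hasFDerivAt.comp_hasDerivWithinAt _
    (HasFDerivAt.comp_hasDerivWithinAt (l := A.fermi) t h3 h2)
  have h5 : ((fderiv ℝ A.fermi (F t x).2) (ν t x).2).2 = 1 := by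
    rw [hx.normal_eq (hF.surface t ht) hangle]
    have := A.fderiv_fermi_normalVel (A.fermi (F t x).2)
    rwa [A.normalExp_fermi ((hF.surface t ht).mem x)] at this
  refine (h4.congr (fun s hs => A.height_eq ((hF.surface s hs).mem x))
    (A.height_eq ((hF.surface t ht).mem x))).congr_deriv ?_
  simp only [ContinuousLinearMap.coe_snd', map_smul, smul_eq_mul, h5]
  ring

end AlmostFuchsian

/-! ### The maximum principle -/

/-- The minimum principle for functions on the product of an interval with a space `S` that is
compact up to a symmetry of the function: a function that is nonnegative at the initial time remains
so if it does not decrease at its negative spatial minima. -/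
lemma nonneg_of_spatial_min {S : Type*} [TopologicalSpace S] {a b : ℝ} {K : Set S}
    (hK : IsCompact K) {g : ℝ → S → ℝ}
    (hcov : ∀ x, ∃ y ∈ K, ∀ t ∈ Icc a b, g t y = g t x)
    (hg : ContinuousOn (fun z : ℝ × S => g z.1 z.2) (Icc a b ×ˢ K))
    (h0 : ∀ x, 0 ≤ g a x)
    (hstep : ∀ t ∈ Icc a b, ∀ x, (∀ y, g t x ≤ g t y) → g t x < 0 →
      ∃ d, 0 ≤ d ∧ HasDerivWithinAt (fun s => g s x) d (Icc a b) t) :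
    ∀ t ∈ Icc a b, ∀ x, 0 ≤ g t x := by
  by_contra! hneg
  obtain ⟨t₁, ht₁, x₁, hx₁⟩ := hneg
  obtain ⟨y₁, hy₁, hgy₁⟩ := hcov x₁
  have hab : 0 ≤ t₁ - a := sub_nonneg.2 ht₁.1
  -- The function `g + ε (t - a)` still has a negative minimum, at a time `t > a`, and its time
  -- derivative there is positive.
  set ε := -g t₁ x₁ / (2 * (t₁ - a + 1)) with hε
  have hε0 : 0 < ε := div_pos (by linarith) (by linarith)
  have hε1 : ε * (t₁ - a) < -g t₁ x₁ := by
    have h1 : ε * (2 * (t₁ - a + 1)) = -g t₁ x₁ := div_mul_cancel₀ _ (by linarith)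
    nlinarith
  have hcont : ContinuousOn (fun z : ℝ × S => g z.1 z.2 + ε * (z.1 - a)) (Icc a b ×ˢ K) :=
    hg.add (by fun_prop)
  obtain ⟨⟨t₀, x₀⟩, ⟨ht₀, hx₀⟩, hmin⟩ := (isCompact_Icc.prod hK).exists_isMinOn
    ⟨(t₁, y₁), ht₁, hy₁⟩ hcont
  have hmin' : ∀ t ∈ Icc a b, ∀ y ∈ K, g t₀ x₀ + ε * (t₀ - a) ≤ g t y + ε * (t - a) :=
    fun t ht y hy => hmin (show (t, y) ∈ Icc a b ×ˢ K from ⟨ht, hy⟩)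
  have hlt : g t₀ x₀ + ε * (t₀ - a) < 0 := by
    have := hmin' t₁ ht₁ y₁ hy₁
    rw [hgy₁ t₁ ht₁] at this
    linarith
  have ht0a : a < t₀ := by
    refine lt_of_le_of_ne ht₀.1 fun h => ?_
    have := h0 x₀
    rw [← h, sub_self, mul_zero, add_zero] at hlt
    linarith
  obtain ⟨d, hd, hderiv⟩ := hstep t₀ ht₀ x₀ (fun y => by
    obtain ⟨y', hy', hgy'⟩ := hcov y
    have := hmin' t₀ ht₀ y' hy'
    rw [hgy' t₀ ht₀] at this
    linarith) (by nlinarith)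
  have hloc : IsLocalMinOn (fun s => g s x₀ + ε * (s - a)) (Icc a b) t₀ :=
    Filter.eventually_of_mem self_mem_nhdsWithin fun s hs => hmin' s hs x₀ hx₀
  have hderiv' : HasDerivWithinAt (fun s => g s x₀ + ε * (s - a)) (d + ε) (Icc a b) t₀ := by
    have := (((hasDerivWithinAt_id t₀ (Icc a b)).sub_const a).const_mul ε)
    exact (hderiv.add this).congr_deriv (by ring)
  have := hloc.hasFDerivWithinAt_nonneg hderiv'.hasFDerivWithinAt (y := a - t₀)
    (sub_mem_posTangentConeAt_of_segment_subset (by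
      rw [segment_symm, segment_eq_Icc ht₀.1]
      exact Icc_subset_Icc_right ht₀.2))
  simp at this
  nlinarith

/-- Comparison of the spatial minimum with a solution `y` of `(sinh (y - r))' = -τ sinh (y - r)`. -/
lemma le_sinh_of_spatial_min {S : Type*} [TopologicalSpace S] {a b : ℝ} {K : Set S}
    (hK : IsCompact K) {u : ℝ → S → ℝ}
    (hcov : ∀ x, ∃ y ∈ K, ∀ t ∈ Icc a b, u t y = u t x)
    (hu : ContinuousOn (fun z : ℝ × S => u z.1 z.2) (Icc a b ×ˢ K)) {r τ s₀ : ℝ}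
    (h0 : ∀ x, s₀ ≤ Real.sinh (u a x - r))
    (hstep : ∀ t ∈ Icc a b, ∀ x, (∀ y, u t x ≤ u t y) →
      Real.sinh (u t x - r) < Real.exp (-τ * (t - a)) * s₀ →
      ∃ d, HasDerivWithinAt (fun s => u s x) d (Icc a b) t ∧
        0 ≤ τ * Real.sinh (u t x - r) + Real.cosh (u t x - r) * d) :
    ∀ t ∈ Icc a b, ∀ x, Real.exp (-τ * (t - a)) * s₀ ≤ Real.sinh (u t x - r) := by
  have hexp : ∀ t, Real.exp (-τ * (t - a)) * Real.exp (τ * (t - a)) = 1 := fun t => by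
    rw [← Real.exp_add, ← Real.exp_zero]; congr 1; ring
  have key := nonneg_of_spatial_min hK
    (g := fun t x => Real.exp (τ * (t - a)) * Real.sinh (u t x - r) - s₀) (a := a) (b := b)
    (fun x => by
      obtain ⟨y, hy, hxy⟩ := hcov x
      exact ⟨y, hy, fun t ht => by simp only [hxy t ht]⟩)
    (by
      refine ContinuousOn.sub (ContinuousOn.mul (by fun_prop) ?_) continuousOn_const
      exact Real.continuous_sinh.comp_continuousOn (hu.sub continuousOn_const))
    (fun x => by simpa using h0 x)
    (fun t ht x hmin hlt => by
      have hpos := Real.exp_pos (τ * (t - a))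
      have hpos' := Real.exp_pos (-τ * (t - a))
      obtain ⟨d, hd, hd0⟩ := hstep t ht x (fun y => by
        have h1 := hmin y
        have h2 : Real.sinh (u t x - r) ≤ Real.sinh (u t y - r) :=
          le_of_mul_le_mul_left (by linarith) hpos
        have h3 := Real.sinh_le_sinh.1 h2
        linarith) (by
          have h1 := mul_lt_mul_of_pos_left (sub_neg.1 hlt) hpos'
          rwa [← mul_assoc, hexp, one_mul] at h1)
      refine ⟨Real.exp (τ * (t - a)) *
        (τ * Real.sinh (u t x - r) + Real.cosh (u t x - r) * d), mul_nonneg hpos.le hd0, ?_⟩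
      have h1 : HasDerivWithinAt (fun s => Real.exp (τ * (s - a)))
          (Real.exp (τ * (t - a)) * τ) (Icc a b) t := by
        have := ((((hasDerivAt_id t).sub_const a).const_mul τ).exp).hasDerivWithinAt (s := Icc a b)
        simpa using this
      exact ((h1.mul (hd.sub_const r).sinh).sub_const s₀).congr_deriv (by ring))
  intro t ht x
  have h1 := mul_le_mul_of_nonneg_left (sub_nonneg.1 (key t ht x)) (Real.exp_pos (-τ * (t - a))).le
  rwa [← mul_assoc, hexp, one_mul] at h1

/-- Comparison of the spatial maximum with a solution `y` of `(sinh (y - r))' = -τ sinh (y - r)`. -/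
lemma sinh_le_of_spatial_max {S : Type*} [TopologicalSpace S] {a b : ℝ} {K : Set S}
    (hK : IsCompact K) {u : ℝ → S → ℝ}
    (hcov : ∀ x, ∃ y ∈ K, ∀ t ∈ Icc a b, u t y = u t x)
    (hu : ContinuousOn (fun z : ℝ × S => u z.1 z.2) (Icc a b ×ˢ K)) {r τ s₀ : ℝ}
    (h0 : ∀ x, Real.sinh (u a x - r) ≤ s₀)
    (hstep : ∀ t ∈ Icc a b, ∀ x, (∀ y, u t y ≤ u t x) →
      Real.exp (-τ * (t - a)) * s₀ < Real.sinh (u t x - r) →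
      ∃ d, HasDerivWithinAt (fun s => u s x) d (Icc a b) t ∧
        τ * Real.sinh (u t x - r) + Real.cosh (u t x - r) * d ≤ 0) :
    ∀ t ∈ Icc a b, ∀ x, Real.sinh (u t x - r) ≤ Real.exp (-τ * (t - a)) * s₀ := by
  have hs : ∀ y, -y - -r = -(y - r) := fun y => by ring
  have key := le_sinh_of_spatial_min hK (u := fun t x => -u t x) (r := -r) (τ := τ) (s₀ := -s₀)
    (a := a) (b := b)
    (fun x => by
      obtain ⟨y, hy, hxy⟩ := hcov x
      exact ⟨y, hy, fun t ht => by rw [hxy t ht]⟩) hu.neg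
    (fun x => by
      rw [hs, Real.sinh_neg]
      exact neg_le_neg (h0 x))
    (fun t ht x hmin hlt => by
      rw [hs, Real.sinh_neg] at hlt
      obtain ⟨d, hd, hd0⟩ := hstep t ht x (fun y => neg_le_neg_iff.1 (hmin y)) (by linarith)
      refine ⟨-d, hd.neg, ?_⟩
      rw [hs, Real.sinh_neg, Real.cosh_neg]
      linarith)
  intro t ht x
  have := key t ht x
  rw [hs, Real.sinh_neg] at this
  linarith

/-! ### Estimates for the mean curvature of the equidistant surfaces -/

lemma cosh_sub_eq (x y : ℝ) : Real.cosh (x - y) =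
    Real.cosh x * Real.cosh y * (1 - Real.tanh x * Real.tanh y) := by
  have h1 := (Real.cosh_pos x).ne'
  have h2 := (Real.cosh_pos y).ne'
  rw [Real.cosh_sub, Real.tanh_eq_sinh_div_cosh, Real.tanh_eq_sinh_div_cosh]
  field_simp

lemma sinh_sub_eq (x y : ℝ) : Real.sinh (x - y) =
    Real.cosh x * Real.cosh y * (Real.tanh x - Real.tanh y) := by
  have h1 := (Real.cosh_pos x).ne'
  have h2 := (Real.cosh_pos y).ne'
  rw [Real.sinh_sub, Real.tanh_eq_sinh_div_cosh, Real.tanh_eq_sinh_div_cosh]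
  field_simp

lemma tanh_nonneg_of_nonneg {x : ℝ} (hx : 0 ≤ x) : 0 ≤ Real.tanh x := by
  rw [Real.tanh_eq_sinh_div_cosh]
  exact div_nonneg (Real.sinh_nonneg_iff.2 hx) (Real.cosh_pos x).le

lemma tanh_le_tanh_of_le {x y : ℝ} (hxy : x ≤ y) : Real.tanh x ≤ Real.tanh y := by
  have h : 0 ≤ Real.sinh (y - x) := Real.sinh_nonneg_iff.2 (sub_nonneg.2 hxy)
  rw [sinh_sub_eq] at h
  have := nonneg_of_mul_nonneg_right h (mul_pos (Real.cosh_pos y) (Real.cosh_pos x))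
  linarith

namespace AlmostFuchsian

lemma levelMeanCurv_eq (r m : ℝ) : levelMeanCurv r m =
    2 * Real.tanh r * (1 - m) / (1 - Real.tanh r ^ 2 * m) := by
  have h1 := (Real.cosh_pos r).ne'
  rw [levelMeanCurv, Real.tanh_eq_sinh_div_cosh]
  have h2 : 1 - (Real.sinh r / Real.cosh r) ^ 2 * m =
      (Real.cosh r ^ 2 - Real.sinh r ^ 2 * m) / Real.cosh r ^ 2 := by
    field_simp
  rw [h2]
  by_cases h0 : Real.cosh r ^ 2 - Real.sinh r ^ 2 * m = 0
  · simp [h0]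
  · field_simp

lemma one_sub_tanh_sq_mul_pos (r : ℝ) {m : ℝ} (hm : m < 1) (hm0 : 0 ≤ m) :
    0 < 1 - Real.tanh r ^ 2 * m := by
  have := Real.tanh_lt_one r
  have := Real.neg_one_lt_tanh r
  have h : Real.tanh r ^ 2 ≤ 1 := by nlinarith
  nlinarith

lemma levelMeanCurv_nonpos {r m : ℝ} (hr : r ≤ 0) (hm0 : 0 ≤ m) (hm : m < 1) :
    levelMeanCurv r m ≤ 0 := by
  rw [levelMeanCurv_eq]
  have h1 := tanh_le_tanh_of_le hr
  rw [Real.tanh_zero] at h1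
  refine div_nonpos_of_nonpos_of_nonneg ?_ (one_sub_tanh_sq_mul_pos r hm hm0).le
  exact mul_nonpos_of_nonpos_of_nonneg (by linarith) (by linarith)

lemma levelMeanCurv_le {r m : ℝ} (hr : 0 ≤ r) (hm0 : 0 ≤ m) (hm : m < 1) :
    levelMeanCurv r m ≤ 2 * Real.tanh r := by
  rw [levelMeanCurv_eq, div_le_iff₀ (one_sub_tanh_sq_mul_pos r hm hm0)]
  have h1 := tanh_nonneg_of_nonneg hr
  have h2 := Real.tanh_lt_one r
  have h3 : Real.tanh r ^ 2 ≤ 1 := by nlinarith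
  exact mul_le_mul_of_nonneg_left (by nlinarith) (by linarith)

lemma levelMeanCurv_anti {r m l : ℝ} (hr : 0 ≤ r) (hm0 : 0 ≤ m) (hml : m ≤ l) (hl : l < 1) :
    levelMeanCurv r l ≤ levelMeanCurv r m := by
  rw [levelMeanCurv_eq, levelMeanCurv_eq,
    div_le_div_iff₀ (one_sub_tanh_sq_mul_pos r hl (hm0.trans hml))
      (one_sub_tanh_sq_mul_pos r (hml.trans_lt hl) hm0)]
  have h1 := tanh_nonneg_of_nonneg hr
  have h2 := Real.tanh_lt_one r
  have h3 : 0 ≤ 1 - Real.tanh r ^ 2 := by nlinarith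
  have h4 := mul_nonneg h1 (mul_nonneg (sub_nonneg.2 hml) h3)
  nlinarith

section Constants

variable {c : ℝ} (hc : 0 ≤ c) (hc2 : c < 2)
include hc

lemma rc_nonneg : 0 ≤ rc c := Real.artanh_nonneg (by linarith)

include hc2

lemma tanh_rc : Real.tanh (rc c) = c / 2 :=
  Real.tanh_artanh ⟨by linarith, by linarith⟩

/-- The differential inequality satisfied by `sinh (u - r_c)` at a lowest point. -/
lemma exists_le_cosh_mul {u m H : ℝ} (hu : 0 ≤ u) (hm0 : 0 ≤ m) (hm : m < 1)
    (hH : H ≤ levelMeanCurv u m) :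
    ∃ k, 2 - c ≤ k ∧ k ≤ 2 ∧ -k * Real.sinh (u - rc c) ≤ Real.cosh (u - rc c) * (c - H) := by
  have hH' := hH.trans (levelMeanCurv_le hu hm0 hm)
  have h1 := tanh_nonneg_of_nonneg hu
  have h2 := Real.tanh_lt_one u
  refine ⟨2 * (1 - Real.tanh u * (c / 2)), by nlinarith, by nlinarith, ?_⟩
  rw [cosh_sub_eq, sinh_sub_eq, tanh_rc hc hc2]
  have hP := mul_pos (Real.cosh_pos u) (Real.cosh_pos (rc c))
  set P := Real.cosh u * Real.cosh (rc c)
  have hk : 0 < 1 - Real.tanh u * (c / 2) := by nlinarith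
  have h3 := mul_le_mul_of_nonneg_left (show c - 2 * Real.tanh u ≤ c - H by linarith)
    (mul_pos hP hk).le
  linarith

/-- The denominator in the definition of `r̃_c` exceeds `c`, so that the value of `artanh`
there is not a junk value. -/
lemma rcTilde_bounds {lam b₀ : ℝ} (hb0 : 0 < b₀) (hl : lam ^ 2 ≤ (2 - c) / 4) :
    (2 + c) / 2 ≤ 2 - (2 - c * Real.tanh (bTilde c b₀)) * lam ^ 2 ∧
      2 - (2 - c * Real.tanh (bTilde c b₀)) * lam ^ 2 ≤ 2 ∧
      Real.tanh (rcTilde c lam b₀) =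
        c / (2 - (2 - c * Real.tanh (bTilde c b₀)) * lam ^ 2) := by
  have hb : 0 ≤ bTilde c b₀ := le_min hb0.le (rc_nonneg hc)
  have h1 := tanh_nonneg_of_nonneg hb
  have h2 := Real.tanh_lt_one (bTilde c b₀)
  have h3 : 0 ≤ c * Real.tanh (bTilde c b₀) := mul_nonneg hc h1
  have h4 : c * Real.tanh (bTilde c b₀) ≤ c := by nlinarith
  have h5 := mul_nonneg h3 (sq_nonneg lam)
  have hD : (2 + c) / 2 ≤ 2 - (2 - c * Real.tanh (bTilde c b₀)) * lam ^ 2 := by nlinarith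
  refine ⟨hD, by nlinarith [sq_nonneg lam], ?_⟩
  have hD0 : 0 < 2 - (2 - c * Real.tanh (bTilde c b₀)) * lam ^ 2 := by linarith
  refine Real.tanh_artanh ⟨?_, ?_⟩
  · exact lt_of_lt_of_le (by norm_num) (div_nonneg hc hD0.le)
  · rw [div_lt_one hD0]; linarith

/-- The differential inequality satisfied by `sinh (u - r̃_c)` at a highest point. -/
lemma exists_cosh_mul_le {lam b₀ u m H : ℝ} (hb0 : 0 < b₀) (hl : lam ^ 2 ≤ (2 - c) / 4)
    (hu : bTilde c b₀ ≤ u) (hm0 : 0 ≤ m) (hm : m ≤ lam ^ 2) (hH : levelMeanCurv u m ≤ H) :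
    ∃ k, (2 - c) / 4 ≤ k ∧ (u ≤ rcTilde c lam b₀ → k ≤ 4) ∧
      Real.cosh (u - rcTilde c lam b₀) * (c - H) ≤ -k * Real.sinh (u - rcTilde c lam b₀) := by
  obtain ⟨hD1, hD2, hR⟩ := rcTilde_bounds hc hc2 hb0 hl
  have hb : 0 ≤ bTilde c b₀ := le_min hb0.le (rc_nonneg hc)
  have hl1 : lam ^ 2 < 1 := by linarith
  have hH' := (levelMeanCurv_anti (hb.trans hu) hm0 hm hl1).trans hH
  rw [levelMeanCurv_eq] at hH'
  have hden := one_sub_tanh_sq_mul_pos u hl1 (sq_nonneg lam)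
  have hT0 := tanh_nonneg_of_nonneg (hb.trans hu)
  have hT1 := Real.tanh_lt_one u
  have hTb := tanh_le_tanh_of_le hu
  have hTR : u ≤ rcTilde c lam b₀ → Real.tanh u ≤ Real.tanh (rcTilde c lam b₀) := tanh_le_tanh_of_le
  rw [cosh_sub_eq, sinh_sub_eq]
  have hP := mul_pos (Real.cosh_pos u) (Real.cosh_pos (rcTilde c lam b₀))
  set P := Real.cosh u * Real.cosh (rcTilde c lam b₀)
  set D := 2 - (2 - c * Real.tanh (bTilde c b₀)) * lam ^ 2 with hD
  set Q := Real.tanh (rcTilde c lam b₀)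
  set T := Real.tanh u
  set B := Real.tanh (bTilde c b₀)
  set l := lam ^ 2
  have hl0 : 0 ≤ l := sq_nonneg lam
  have hD0 : 0 < D := by linarith
  have hDQ : D * Q = c := by rw [hR]; field_simp
  have hnum : (2 - c) / 2 ≤ D * (1 - T * Q) := by
    have : D * (1 - T * Q) = D - c * T := by rw [← hDQ]; ring
    rw [this]; nlinarith
  have hTQ : 0 < 1 - T * Q := pos_of_mul_pos_right (by linarith) hD0.le
  have hden1 : 1 - T ^ 2 * l ≤ 1 := by nlinarith [sq_nonneg T]
  refine ⟨D * (1 - T * Q) / (1 - T ^ 2 * l), ?_, fun hle => ?_, ?_⟩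
  · rw [le_div_iff₀ hden]
    nlinarith
  · rw [div_le_iff₀ hden]
    have h1 : 1 - T * Q ≤ 1 - T ^ 2 * l := by
      have := hTR hle
      have h2 : T * T ≤ T * Q := mul_le_mul_of_nonneg_left this hT0
      nlinarith [sq_nonneg T]
    nlinarith
  · have h1 : c - H ≤ -D * (T - Q) / (1 - T ^ 2 * l) := by
      have h2 : c - 2 * T * (1 - l) / (1 - T ^ 2 * l) ≤ -D * (T - Q) / (1 - T ^ 2 * l) := by
        rw [← sub_nonneg]
        have h3 : -D * (T - Q) / (1 - T ^ 2 * l) - (c - 2 * T * (1 - l) / (1 - T ^ 2 * l)) =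
            (c * l * T * (T - B)) / (1 - T ^ 2 * l) := by
          field_simp
          rw [mul_sub, hDQ, hD]
          ring
        rw [h3]
        exact div_nonneg (mul_nonneg (by positivity) (sub_nonneg.2 hTb)) hden.le
      linarith
    have h2 := mul_le_mul_of_nonneg_left h1 (mul_pos hP hTQ).le
    refine h2.trans (le_of_eq ?_)
    ring

end Constants

end AlmostFuchsian

/-! ### The height along the flow -/

namespace AlmostFuchsian

variable {A : AlmostFuchsian} {S : Type*} [TopologicalSpace S] [ChartedSpace Plane S]
  {ρ : A.Γ →* Equiv.Perm S}

lemma continuous_height_comp {F ν : S → Mink} (h : IsClosedSurface A.Γ ρ F ν) :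
    Continuous fun x => A.height (F x) := by
  have h1 : Continuous fun x => (A.fermi (F x).2).2 :=
    continuous_snd.comp (A.contDiff_fermi.continuous.comp (continuous_snd.comp h.smooth.continuous))
  exact h1.congr fun x => (A.height_eq (h.mem x)).symm

lemma height_comp_smul {F ν : S → Mink} (h : IsClosedSurface A.Γ ρ F ν) (γ : A.Γ) (x : S) :
    A.height (F (ρ γ x)) = A.height (F x) := by
  rw [h.equivariant, A.height_smul γ (h.mem x)]

/-- The height attains its extrema over a closed surface. -/
lemma isLeast_minHeight_isGreatest_maxHeight [Nonempty S] {F ν : S → Mink}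
    (h : IsClosedSurface A.Γ ρ F ν) :
    IsLeast (range fun x => A.height (F x)) (A.minHeight F) ∧
      IsGreatest (range fun x => A.height (F x)) (A.maxHeight F) := by
  obtain ⟨K, hK, hcov⟩ := h.cocompact
  have hrange : (range fun x => A.height (F x)) = (fun x => A.height (F x)) '' K := by
    refine Subset.antisymm ?_ (image_subset_range _ _)
    rintro _ ⟨x, rfl⟩
    obtain ⟨γ, hγ⟩ := hcov x
    exact ⟨_, hγ, height_comp_smul h γ x⟩
  have hcpt : IsCompact (range fun x => A.height (F x)) :=
    hrange ▸ hK.image (continuous_height_comp h)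
  exact ⟨hcpt.isLeast_sInf (range_nonempty _), hcpt.isGreatest_sSup (range_nonempty _)⟩

variable {c T : ℝ} {F ν : ℝ → S → Mink}

lemma continuousOn_height_flow (hF : IsMMCF A.Γ ρ c T F ν) :
    ContinuousOn (fun z : ℝ × S => A.height (F z.1 z.2)) (Icc 0 T ×ˢ univ) := by
  have h1 : ContinuousOn (fun z : ℝ × S => (A.fermi (F z.1 z.2).2).2) (Icc 0 T ×ˢ univ) :=
    (continuous_snd.comp (A.contDiff_fermi.continuous.comp continuous_snd)).comp_continuousOn
      hF.smooth.continuousOn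
  exact h1.congr fun z hz => A.height_eq ((hF.surface z.1 hz.1).mem z.2)

/-- A compact set that contains a point of every orbit, for the whole time interval. -/
lemma exists_isCompact_flow (hT : 0 ≤ T) (hF : IsMMCF A.Γ ρ c T F ν) :
    ∃ K : Set S, IsCompact K ∧
      ∀ x, ∃ y ∈ K, ∀ t ∈ Icc 0 T, A.height (F t y) = A.height (F t x) := by
  obtain ⟨K, hK, hcov⟩ := (hF.surface 0 ⟨le_rfl, hT⟩).cocompact
  refine ⟨K, hK, fun x => ?_⟩
  obtain ⟨γ, hγ⟩ := hcov x
  exact ⟨_, hγ, fun t ht => height_comp_smul (hF.surface t ht) γ x⟩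

variable [IsManifold (𝓡 2) ∞ S]

/-- The minimum principle for the height along the flow, with the mean curvature at a lowest point
estimated by that of an equidistant surface. -/
lemma le_sinh_height (hF : IsMMCF A.Γ ρ c T F ν)
    (hangle : ∀ t ∈ Icc 0 T, ∀ x, A.AngleNonneg (F t x) (ν t x)) {a b : ℝ} (ha : 0 ≤ a)
    (hb : b ≤ T) {r τ s₀ : ℝ} (h0 : ∀ x, s₀ ≤ Real.sinh (A.height (F a x) - r))
    (hstep : ∀ t ∈ Icc a b, ∀ x m H, 0 ≤ m → m < 1 →
      H ≤ levelMeanCurv (A.height (F t x)) m →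
      Real.sinh (A.height (F t x) - r) < Real.exp (-τ * (t - a)) * s₀ →
      0 ≤ τ * Real.sinh (A.height (F t x) - r) + Real.cosh (A.height (F t x) - r) * (c - H)) :
    ∀ t ∈ Icc a b, ∀ x, Real.exp (-τ * (t - a)) * s₀ ≤ Real.sinh (A.height (F t x) - r) := by
  intro t ht
  have hT : 0 ≤ T := ha.trans (ht.1.trans (ht.2.trans hb))
  have hsub : Icc a b ⊆ Icc 0 T := Icc_subset_Icc ha hb
  obtain ⟨K, hK, hcov⟩ := exists_isCompact_flow hT hF
  refine le_sinh_of_spatial_min hK (u := fun t x => A.height (F t x)) (b := b)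
    (fun x => ?_) ((continuousOn_height_flow hF).mono (prod_mono hsub (subset_univ K))) h0 ?_ t ht
  · obtain ⟨y, hy, h⟩ := hcov x
    exact ⟨y, hy, fun t ht => h t (hsub ht)⟩
  · intro t ht x hmin hlt
    obtain ⟨hx, m, hm0, hm, -, hH⟩ :=
      exists_surfMeanCurv_le (hF.surface t (hsub ht)) (hangle t (hsub ht) x) hmin
    exact ⟨_, (hasDerivWithinAt_height hF (hsub ht) hx (hangle t (hsub ht) x)).mono hsub,
      hstep t ht x m _ hm0 hm hH hlt⟩

/-- The maximum principle for the height along the flow, with the mean curvature at a highest point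
estimated by that of an equidistant surface. -/
lemma sinh_height_le (hF : IsMMCF A.Γ ρ c T F ν)
    (hangle : ∀ t ∈ Icc 0 T, ∀ x, A.AngleNonneg (F t x) (ν t x)) {lam : ℝ}
    (hlam : ∀ κ ∈ A.principalCurvs, κ ≤ lam) {a b : ℝ} (ha : 0 ≤ a)
    (hb : b ≤ T) {r τ s₀ : ℝ} (h0 : ∀ x, Real.sinh (A.height (F a x) - r) ≤ s₀)
    (hstep : ∀ t ∈ Icc a b, ∀ x m H, 0 ≤ m → m ≤ lam ^ 2 →
      levelMeanCurv (A.height (F t x)) m ≤ H →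
      Real.exp (-τ * (t - a)) * s₀ < Real.sinh (A.height (F t x) - r) →
      τ * Real.sinh (A.height (F t x) - r) + Real.cosh (A.height (F t x) - r) * (c - H) ≤ 0) :
    ∀ t ∈ Icc a b, ∀ x, Real.sinh (A.height (F t x) - r) ≤ Real.exp (-τ * (t - a)) * s₀ := by
  intro t ht
  have hT : 0 ≤ T := ha.trans (ht.1.trans (ht.2.trans hb))
  have hsub : Icc a b ⊆ Icc 0 T := Icc_subset_Icc ha hb
  obtain ⟨K, hK, hcov⟩ := exists_isCompact_flow hT hF
  refine sinh_le_of_spatial_max hK (u := fun t x => A.height (F t x)) (b := b)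
    (fun x => ?_) ((continuousOn_height_flow hF).mono (prod_mono hsub (subset_univ K))) h0 ?_ t ht
  · obtain ⟨y, hy, h⟩ := hcov x
    exact ⟨y, hy, fun t ht => h t (hsub ht)⟩
  · intro t ht x hmax hlt
    obtain ⟨hx, m, hm0, -, hp, hH⟩ :=
      exists_le_surfMeanCurv (hF.surface t (hsub ht)) (hangle t (hsub ht) x) hmax
    have hm : m ≤ lam ^ 2 := (Real.sqrt_le_left ((Real.sqrt_nonneg m).trans (hlam _ hp))).1
      (hlam _ hp)
    exact ⟨_, (hasDerivWithinAt_height hF (hsub ht) hx (hangle t (hsub ht) x)).mono hsub,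
      hstep t ht x m _ hm0 hm hH hlt⟩

section Barriers

variable (hc : 0 ≤ c) (hc2 : c < 2) (hF : IsMMCF A.Γ ρ c T F ν)
  (hangle : ∀ t ∈ Icc 0 T, ∀ x, A.AngleNonneg (F t x) (ν t x)) {a b : ℝ} (ha : 0 ≤ a) (hb : b ≤ T)
include hc hc2 hF hangle ha hb

/-- Equidistant surfaces of height at most `r_c` are lower barriers. -/
lemma le_height_of_le_rc {w : ℝ} (hw : w ≤ rc c) (h0 : ∀ x, w ≤ A.height (F a x)) :
    ∀ t ∈ Icc a b, ∀ x, w ≤ A.height (F t x) := by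
  have key := le_sinh_height hF hangle ha hb (r := rc c) (τ := 0) (s₀ := Real.sinh (w - rc c))
    (fun x => Real.sinh_le_sinh.2 (by linarith [h0 x])) (fun t ht x m H hm0 hm hH hlt => by
      rw [neg_zero, zero_mul, Real.exp_zero, one_mul, Real.sinh_lt_sinh] at hlt
      rw [zero_mul, zero_add]
      rcases le_total 0 (A.height (F t x)) with hu | hu
      · obtain ⟨k, hk1, -, hk⟩ := exists_le_cosh_mul hc hc2 hu hm0 hm hH
        have hs : Real.sinh (A.height (F t x) - rc c) ≤ 0 := Real.sinh_nonpos_iff.2 (by linarith)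
        nlinarith
      · have := hH.trans (levelMeanCurv_nonpos hu hm0 hm)
        exact mul_nonneg (Real.cosh_pos _).le (by linarith))
  intro t ht x
  have := key t ht x
  rw [neg_zero, zero_mul, Real.exp_zero, one_mul, Real.sinh_le_sinh] at this
  linarith

/-- The lower barrier that descends to `r_c`. -/
lemma exp_mul_sinh_le_of_rc_le {w : ℝ} (hw : rc c ≤ w) (h0 : ∀ x, w ≤ A.height (F a x)) :
    ∀ t ∈ Icc a b, ∀ x, Real.exp (-4 * (t - a)) * Real.sinh (w - rc c) ≤
      Real.sinh (A.height (F t x) - rc c) := by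
  have hbarrier := le_height_of_le_rc hc hc2 hF hangle ha hb le_rfl fun x => hw.trans (h0 x)
  refine le_sinh_height hF hangle ha hb
    (fun x => Real.sinh_le_sinh.2 (by linarith [h0 x])) (fun t ht x m H hm0 hm hH hlt => ?_)
  have hu := hbarrier t ht x
  obtain ⟨k, hk1, hk2, hk⟩ :=
    exists_le_cosh_mul hc hc2 ((rc_nonneg hc).trans hu) hm0 hm hH
  have hs : 0 ≤ Real.sinh (A.height (F t x) - rc c) := Real.sinh_nonneg_iff.2 (by linarith)
  nlinarith

/-- The lower barrier that rises to `r_c`. -/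
lemma exp_mul_sinh_le_of_le_rc {w : ℝ} (hw0 : 0 ≤ w) (hw : w ≤ rc c)
    (h0 : ∀ x, w ≤ A.height (F a x)) :
    ∀ t ∈ Icc a b, ∀ x, Real.exp (-((2 - c) / 4) * (t - a)) * Real.sinh (w - rc c) ≤
      Real.sinh (A.height (F t x) - rc c) := by
  have hbarrier := le_height_of_le_rc hc hc2 hF hangle ha hb hw h0
  refine le_sinh_height hF hangle ha hb
    (fun x => Real.sinh_le_sinh.2 (by linarith [h0 x])) (fun t ht x m H hm0 hm hH hlt => ?_)
  have hu := hbarrier t ht x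
  obtain ⟨k, hk1, hk2, hk⟩ := exists_le_cosh_mul hc hc2 (hw0.trans hu) hm0 hm hH
  have hs : Real.sinh (A.height (F t x) - rc c) ≤ 0 :=
    hlt.le.trans (mul_nonpos_of_nonneg_of_nonpos (Real.exp_pos _).le
      (Real.sinh_nonpos_iff.2 (by linarith)))
  nlinarith

variable {lam b₀ : ℝ} (hlam : ∀ κ ∈ A.principalCurvs, κ ≤ lam) (hl : lam ^ 2 ≤ (2 - c) / 4)
  (hb0 : 0 < b₀) (hlow : ∀ t ∈ Icc 0 T, ∀ x, bTilde c b₀ ≤ A.height (F t x))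
include hlam hl hb0 hlow

/-- Equidistant surfaces of height at least `r̃_c` are upper barriers. -/
lemma height_le_of_rcTilde_le {w : ℝ} (hw : rcTilde c lam b₀ ≤ w)
    (h0 : ∀ x, A.height (F a x) ≤ w) :
    ∀ t ∈ Icc a b, ∀ x, A.height (F t x) ≤ w := by
  have key := sinh_height_le hF hangle hlam ha hb (r := rcTilde c lam b₀) (τ := 0)
    (s₀ := Real.sinh (w - rcTilde c lam b₀))
    (fun x => Real.sinh_le_sinh.2 (by linarith [h0 x])) (fun t ht x m H hm0 hm hH hlt => by
      rw [neg_zero, zero_mul, Real.exp_zero, one_mul, Real.sinh_lt_sinh] at hlt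
      rw [zero_mul, zero_add]
      obtain ⟨k, hk1, -, hk⟩ := exists_cosh_mul_le hc hc2 hb0 hl
        (hlow t ⟨ha.trans ht.1, ht.2.trans hb⟩ x) hm0 hm hH
      have hs : 0 ≤ Real.sinh (A.height (F t x) - rcTilde c lam b₀) :=
        Real.sinh_nonneg_iff.2 (by linarith)
      nlinarith)
  intro t ht x
  have := key t ht x
  rw [neg_zero, zero_mul, Real.exp_zero, one_mul, Real.sinh_le_sinh] at this
  linarith

/-- The upper barrier that rises to `r̃_c`. -/
lemma sinh_le_exp_mul_of_le_rcTilde {w : ℝ} (hw : w ≤ rcTilde c lam b₀)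
    (h0 : ∀ x, A.height (F a x) ≤ w) :
    ∀ t ∈ Icc a b, ∀ x, Real.sinh (A.height (F t x) - rcTilde c lam b₀) ≤
      Real.exp (-4 * (t - a)) * Real.sinh (w - rcTilde c lam b₀) := by
  have hbarrier := height_le_of_rcTilde_le hc hc2 hF hangle ha hb hlam hl hb0 hlow le_rfl
    fun x => (h0 x).trans hw
  refine sinh_height_le hF hangle hlam ha hb
    (fun x => Real.sinh_le_sinh.2 (by linarith [h0 x])) (fun t ht x m H hm0 hm hH hlt => ?_)
  have hu := hbarrier t ht x
  obtain ⟨k, hk1, hk2, hk⟩ := exists_cosh_mul_le hc hc2 hb0 hl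
    (hlow t ⟨ha.trans ht.1, ht.2.trans hb⟩ x) hm0 hm hH
  have hs : Real.sinh (A.height (F t x) - rcTilde c lam b₀) ≤ 0 :=
    Real.sinh_nonpos_iff.2 (by linarith)
  nlinarith [hk2 hu]

/-- The upper barrier that descends to `r̃_c`. -/
lemma sinh_le_exp_mul_of_rcTilde_le {w : ℝ} (hw : rcTilde c lam b₀ ≤ w)
    (h0 : ∀ x, A.height (F a x) ≤ w) :
    ∀ t ∈ Icc a b, ∀ x, Real.sinh (A.height (F t x) - rcTilde c lam b₀) ≤
      Real.exp (-((2 - c) / 4) * (t - a)) * Real.sinh (w - rcTilde c lam b₀) := by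
  refine sinh_height_le hF hangle hlam ha hb
    (fun x => Real.sinh_le_sinh.2 (by linarith [h0 x])) (fun t ht x m H hm0 hm hH hlt => ?_)
  obtain ⟨k, hk1, -, hk⟩ := exists_cosh_mul_le hc hc2 hb0 hl
    (hlow t ⟨ha.trans ht.1, ht.2.trans hb⟩ x) hm0 hm hH
  have hs : 0 ≤ Real.sinh (A.height (F t x) - rcTilde c lam b₀) :=
    (mul_nonneg (Real.exp_pos _).le (Real.sinh_nonneg_iff.2 (by linarith))).trans hlt.le
  nlinarith

end Barriers

end AlmostFuchsian

lemma arsinh_add_le {X u r : ℝ} (h : X ≤ Real.sinh (u - r)) : Real.arsinh X + r ≤ u := by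
  have := Real.arsinh_le_arsinh.2 h
  rw [Real.arsinh_sinh] at this
  linarith

lemma le_arsinh_add {X u r : ℝ} (h : Real.sinh (u - r) ≤ X) : u ≤ Real.arsinh X + r := by
  have := Real.arsinh_le_arsinh.2 h
  rw [Real.arsinh_sinh] at this
  linarith

theorem theorem4p2 (A : AlmostFuchsian)
    {S : Type*} [TopologicalSpace S] [T2Space S] [ChartedSpace Plane S] [IsManifold (𝓡 2) ∞ S]
    (ρ : A.Γ →* Equiv.Perm S) (c lam T a₀ b₀ : ℝ) (hc : 0 ≤ c) (hc2 : c < 2)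
    (hlam : IsGreatest A.principalCurvs lam) (hlamc : lam ≤ Real.sqrt (2 - c) / 2)
    (hT : 0 < T) (F ν : ℝ → S → Mink) (hF : IsMMCF A.Γ ρ c T F ν)
    (hangle : ∀ t ∈ Icc 0 T, ∀ x, A.AngleNonneg (F t x) (ν t x))
    (hb : IsLeast (range fun x => A.height (F 0 x)) b₀) (hb0 : 0 < b₀)
    (ha : IsGreatest (range fun x => A.height (F 0 x)) a₀) (ha0 : 0 < a₀) :
    -- the minimum and the maximum of the height over each evolving surface are attained
    (∀ t ∈ Icc 0 T,
      IsLeast (range fun x => A.height (F t x)) (A.minHeight (F t)) ∧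
      IsGreatest (range fun x => A.height (F t x)) (A.maxHeight (F t))) ∧
    -- the barriers
    (∀ T₁ T₂, 0 ≤ T₁ → T₁ ≤ T₂ → T₂ ≤ T → ∀ t ∈ Icc T₁ T₂, ∀ x,
      (rc c ≤ A.minHeight (F T₁) →
        Real.arsinh (Real.exp (-4 * (t - T₁)) * Real.sinh (A.minHeight (F T₁) - rc c)) + rc c
          ≤ A.height (F t x)) ∧
      (A.minHeight (F T₁) ≤ rc c →
        Real.arsinh (Real.exp (-((2 - c) / 4) * (t - T₁)) *
            Real.sinh (A.minHeight (F T₁) - rc c)) + rc c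
          ≤ A.height (F t x)) ∧
      (A.maxHeight (F T₁) ≤ rcTilde c lam b₀ →
        A.height (F t x) ≤
          Real.arsinh (Real.exp (-4 * (t - T₁)) *
            Real.sinh (A.maxHeight (F T₁) - rcTilde c lam b₀)) + rcTilde c lam b₀) ∧
      (rcTilde c lam b₀ ≤ A.maxHeight (F T₁) →
        A.height (F t x) ≤
          Real.arsinh (Real.exp (-((2 - c) / 4) * (t - T₁)) *
            Real.sinh (A.maxHeight (F T₁) - rcTilde c lam b₀)) + rcTilde c lam b₀)) ∧
    -- the uniform bounds
    (∀ t ∈ Icc 0 T, ∀ x,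
      min b₀ (rc c) ≤ A.height (F t x) ∧ A.height (F t x) ≤ max a₀ (rcTilde c lam b₀)) ∧
    -- the flow stays in a compact region of the manifold, which does not depend on `T`
    IsCompact (A.slab (min b₀ (rc c)) (max a₀ (rcTilde c lam b₀))) ∧
    (∀ t ∈ Icc 0 T, ∀ x, ∀ h : F t x ∈ hyp3,
      Quotient.mk A.orbitSetoid ⟨F t x, h⟩ ∈
        A.slab (min b₀ (rc c)) (max a₀ (rcTilde c lam b₀))) := by
  have : Nonempty S := by
    obtain ⟨x, -⟩ := hb.1
    exact ⟨x⟩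
  have hatt : ∀ t ∈ Icc 0 T,
      IsLeast (range fun x => A.height (F t x)) (A.minHeight (F t)) ∧
      IsGreatest (range fun x => A.height (F t x)) (A.maxHeight (F t)) := fun t ht =>
    AlmostFuchsian.isLeast_minHeight_isGreatest_maxHeight (hF.surface t ht)
  have hlam' : ∀ κ ∈ A.principalCurvs, κ ≤ lam := fun κ hκ => hlam.2 hκ
  have hlam0 : 0 ≤ lam := by
    obtain ⟨_, _, m, -, -, hp, -⟩ := A.exists_levelFrame 0
    exact (Real.sqrt_nonneg m).trans (hlam' _ ⟨_, hp⟩)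
  have hl : lam ^ 2 ≤ (2 - c) / 4 := by
    have h1 := pow_le_pow_left₀ hlam0 hlamc 2
    rw [div_pow, Real.sq_sqrt (by linarith)] at h1
    linarith
  have hrc := AlmostFuchsian.rc_nonneg hc
  have hlow : ∀ t ∈ Icc 0 T, ∀ x, bTilde c b₀ ≤ A.height (F t x) :=
    AlmostFuchsian.le_height_of_le_rc hc hc2 hF hangle le_rfl le_rfl (min_le_right _ _)
      fun x => (min_le_left _ _).trans (hb.2 ⟨x, rfl⟩)
  have hbounds : ∀ t ∈ Icc 0 T, ∀ x,
      min b₀ (rc c) ≤ A.height (F t x) ∧ A.height (F t x) ≤ max a₀ (rcTilde c lam b₀) :=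
    fun t ht x => ⟨hlow t ht x,
      AlmostFuchsian.height_le_of_rcTilde_le hc hc2 hF hangle le_rfl le_rfl hlam' hl hb0 hlow
        (le_max_right _ _) (fun x => (ha.2 ⟨x, rfl⟩).trans (le_max_left _ _)) t ht x⟩
  refine ⟨hatt, ?_, hbounds, A.isCompact_slab _ _, fun t ht x h => ⟨_, rfl, hbounds t ht x⟩⟩
  intro T₁ T₂ h1 h12 h2 t ht x
  obtain ⟨hleast, hgreatest⟩ := hatt T₁ ⟨h1, h12.trans h2⟩
  have hmin : ∀ x, A.minHeight (F T₁) ≤ A.height (F T₁ x) := fun x => hleast.2 ⟨x, rfl⟩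
  have hmax : ∀ x, A.height (F T₁ x) ≤ A.maxHeight (F T₁) := fun x => hgreatest.2 ⟨x, rfl⟩
  have hmin0 : 0 ≤ A.minHeight (F T₁) := by
    obtain ⟨y, hy⟩ := hleast.1
    rw [← hy]
    exact (le_min hb0.le hrc).trans (hlow T₁ ⟨h1, h12.trans h2⟩ y)
  refine ⟨fun hw => ?_, fun hw => ?_, fun hw => ?_, fun hw => ?_⟩
  · exact arsinh_add_le
      (AlmostFuchsian.exp_mul_sinh_le_of_rc_le hc hc2 hF hangle h1 h2 hw hmin t ht x)
  · exact arsinh_add_le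
      (AlmostFuchsian.exp_mul_sinh_le_of_le_rc hc hc2 hF hangle h1 h2 hmin0 hw hmin t ht x)
  · exact le_arsinh_add (AlmostFuchsian.sinh_le_exp_mul_of_le_rcTilde hc hc2 hF hangle h1 h2 hlam'
      hl hb0 hlow hw hmax t ht x)
  · exact le_arsinh_add (AlmostFuchsian.sinh_le_exp_mul_of_rcTilde_le hc hc2 hF hangle h1 h2 hlam'
      hl hb0 hlow hw hmax t ht x)
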